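/- Let $(\hat M,g)$ be a compact (Hausdorff, smooth, boundaryless) Riemannian 3-manifold, let $P_0\in\hat M$ and $M=\hat M\setminus\{P_0\}$. Let $\xi$ be a smooth unit vector field on $\hat M$ which is geodesible ($D_\xi\xi=0$ for the Levi-Civita connection $D$) and Killing ($\mathcal L_\xi g=0$). Let $f=Ric(\xi)$ be the Ricci curvature function along $\xi$, normalized as the average of the sectional curvatures of the planes containing $\xi$, i.e. $f=\frac12\,\mathrm{tr}\big(X\mapsto R(X,\xi)\xi\big)$ with $R(X,Y)=D_XD_Y-D_YD_X-D_{[X,Y]}$. Suppose that $f>0$ everywhere on $\hat M$ and that $f$ is equal to a constant $c$ outside a compact subset $K\subset M$. Then $\hat M\setminus K$ is Sasakian (up to the homothety determined by $c$), with $\xi$ as its Reeb direction, in the following sense. There is a smooth field $j$ of orthogonal complex structures on the plane field $\xi^\perp$ over $\hat M$ (the rotation by a right angle, for a suitable orientation) such that on $(\hat M\setminus K)\times(0,\infty)$, with coordinate $t$ on the second factor, the cone metric $$\bar g=t^2g+\frac1c\,dt\otimes dt$$ is Kähler with respect to the endomorphism $J$ given by $J|_{\xi^\perp}=j$, $J(\tfrac1t\xi)=\sqrt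 c\,\partial_t$, $J(\partial_t)=-\tfrac{1}{t\sqrt c}\,\xi$. That is, $\bar g$ is a smooth Riemannian metric, $J$ is a smooth integrable almost complex structure, $\bar g(J\cdot,J\cdot)=\bar g$, and $\Omega=\bar g(J\cdot,\cdot)$ satisfies $d\Omega=0$. -/

import Mathlib

open scoped Manifold ContDiff Bundle Topology

noncomputable section

namespace SasakiCone

section Riemannian

variable {E : Type*} [NormedAddCommGroup E] [NormedSpace ℝ E]
  {H : Type*} [TopologicalSpace H] {I : ModelWithCorners ℝ E H}
  {M : Type*} [TopologicalSpace M] [ChartedSpace H M] [IsManifold I ∞ M]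

/-- The right-hand side of the Koszul formula for `2 g(D_X Y, Z)` at `p`. -/
def koszul (g : Bundle.ContMDiffRiemannianMetric I ∞ E (fun p : M => TangentSpace I p))
    (X Y Z : Π p : M, TangentSpace I p) (p : M) : ℝ :=
  mvfderiv I (fun q => g.inner q (Y q) (Z q)) p (X p)
    + mvfderiv I (fun q => g.inner q (X q) (Z q)) p (Y p)
    - mvfderiv I (fun q => g.inner q (X q) (Y q)) p (Z p)
    + g.inner p (VectorField.mlieBracket I X Y p) (Z p)
    - g.inner p (VectorField.mlieBracket I X Z p) (Y p)
    - g.inner p (VectorField.mlieBracket I Y Z p) (X p)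

/-- The Levi-Civita derivative `D_X Y` at `p`: the (unique) tangent vector `w` at `p` that
satisfies the Koszul formula `2 g(w, Z) = koszul(X, Y, Z)` for all vector fields `Z`. -/
def leviCivita (g : Bundle.ContMDiffRiemannianMetric I ∞ E (fun p : M => TangentSpace I p))
    (X Y : Π p : M, TangentSpace I p) (p : M) : TangentSpace I p :=
  Classical.epsilon fun w : TangentSpace I p =>
    ∀ Z : Π q : M, TangentSpace I q, MDifferentiableAt I I.tangent (T% Z) p →
      2 * g.inner p w (Z p) = koszul g X Y Z p

/-- The curvature `R(X, Y) Z = D_X D_Y Z - D_Y D_X Z - D_[X,Y] Z`. -/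
def curvature (g : Bundle.ContMDiffRiemannianMetric I ∞ E (fun p : M => TangentSpace I p))
    (X Y Z : Π p : M, TangentSpace I p) (p : M) : TangentSpace I p :=
  leviCivita g X (leviCivita g Y Z) p - leviCivita g Y (leviCivita g X Z) p
    - leviCivita g (VectorField.mlieBracket I X Y) Z p

/-- The Ricci tensor `Ric(Y, Z)` at `p`, the trace of the endomorphism `X ↦ R(X, Y) Z` of the
tangent space at `p`, computed in a basis whose vectors are extended to local vector fields. -/
def ricci [FiniteDimensional ℝ E]
    (g : Bundle.ContMDiffRiemannianMetric I ∞ E (fun p : M => TangentSpace I p))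
    (Y Z : Π p : M, TangentSpace I p) (p : M) : ℝ :=
  ∑ i, (Module.finBasis ℝ E).coord i
    (curvature g
      (FiberBundle.extend E (E := fun q : M => TangentSpace I q) (x := p)
        (Module.finBasis ℝ E i)) Y Z p)

/-- The Ricci curvature function of a unit vector field `ξ`, normalized as the average of the
sectional curvatures of the planes containing `ξ`: `Ric(ξ, ξ) / (n - 1)`, where `n = dim M`. -/
def ricciFunction [FiniteDimensional ℝ E]
    (g : Bundle.ContMDiffRiemannianMetric I ∞ E (fun p : M => TangentSpace I p))
    (ξ : Π p : M, TangentSpace I p) (p : M) : ℝ :=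
  ricci g ξ ξ p / ((Module.finrank ℝ E : ℝ) - 1)

/-- `ξ` is a Killing field: `L_ξ g = 0`, that is
`ξ (g(X, Y)) = g([ξ, X], Y) + g(X, [ξ, Y])` for all vector fields `X` and `Y`. -/
def IsKilling (g : Bundle.ContMDiffRiemannianMetric I ∞ E (fun p : M => TangentSpace I p))
    (ξ : Π p : M, TangentSpace I p) : Prop :=
  ∀ (p : M) (X Y : Π q : M, TangentSpace I q),
    MDifferentiableAt I I.tangent (T% X) p → MDifferentiableAt I I.tangent (T% Y) p →
      mvfderiv I (fun q => g.inner q (X q) (Y q)) p (ξ p)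
        = g.inner p (VectorField.mlieBracket I ξ X p) (Y p)
          + g.inner p (X p) (VectorField.mlieBracket I ξ Y p)

/-- `j` is a smooth orthogonal complex structure on the plane field `ξ^⊥` (in dimension three:
the rotation by a right angle in `ξ^⊥`, for one of the orientations), extended by `j ξ = 0`. -/
structure IsTransverseComplexStructure
    (g : Bundle.ContMDiffRiemannianMetric I ∞ E (fun p : M => TangentSpace I p))
    (ξ : Π p : M, TangentSpace I p) (j : Π p : M, TangentSpace I p →L[ℝ] TangentSpace I p) :
    Prop where
  smooth : ∀ (V : Set M) (X : Π p : M, TangentSpace I p), IsOpen V →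
    ContMDiffOn I I.tangent ∞ (T% X) V →
      ContMDiffOn I I.tangent ∞ (T% (fun p => j p (X p))) V
  apply_xi : ∀ p, j p (ξ p) = 0
  mem_perp : ∀ p (v : TangentSpace I p), g.inner p (j p v) (ξ p) = 0
  sq : ∀ p (v : TangentSpace I p), g.inner p v (ξ p) = 0 → j p (j p v) = -v
  orthogonal : ∀ p (v w : TangentSpace I p), g.inner p v (ξ p) = 0 → g.inner p w (ξ p) = 0 →
    g.inner p (j p v) (j p w) = g.inner p v w

/-- The tensor `t² g + (1 / c) dt ⊗ dt` at the point `x = (p, t)` of `M × ℝ`. -/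
def coneMetric (g : Bundle.ContMDiffRiemannianMetric I ∞ E (fun p : M => TangentSpace I p))
    (c : ℝ) (x : M × ℝ) :
    TangentSpace (I.prod 𝓘(ℝ, ℝ)) x →L[ℝ] TangentSpace (I.prod 𝓘(ℝ, ℝ)) x →L[ℝ] ℝ :=
  let G : E →L[ℝ] E →L[ℝ] ℝ := g.inner x.1
  let B : (E × ℝ) →L[ℝ] (E × ℝ) →L[ℝ] ℝ :=
    x.2 ^ 2 • G.bilinearComp (ContinuousLinearMap.fst ℝ E ℝ) (ContinuousLinearMap.fst ℝ E ℝ)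
      + (1 / c) • (ContinuousLinearMap.mul ℝ ℝ).bilinearComp
          (ContinuousLinearMap.snd ℝ E ℝ) (ContinuousLinearMap.snd ℝ E ℝ)
  B

/-- The endomorphism `J` of the tangent space of `M × ℝ` at `x = (p, t)` with `J = j` on `ξ^⊥`,
`J ((1 / t) ξ) = √c ∂_t` and `J (∂_t) = - (1 / (t √c)) ξ`; on a tangent vector `(u, τ)` it is
`J (u, τ) = (j u - (τ / (t √c)) ξ, t √c g(ξ, u))`. -/
def coneJ (g : Bundle.ContMDiffRiemannianMetric I ∞ E (fun p : M => TangentSpace I p))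
    (ξ : Π p : M, TangentSpace I p) (c : ℝ)
    (j : Π p : M, TangentSpace I p →L[ℝ] TangentSpace I p) (x : M × ℝ) :
    TangentSpace (I.prod 𝓘(ℝ, ℝ)) x →L[ℝ] TangentSpace (I.prod 𝓘(ℝ, ℝ)) x :=
  let j' : E →L[ℝ] E := j x.1
  let ξ' : E := ξ x.1
  let θ : E →L[ℝ] ℝ := g.inner x.1 (ξ x.1)
  let A : (E × ℝ) →L[ℝ] (E × ℝ) :=
    (j'.comp (ContinuousLinearMap.fst ℝ E ℝ)
        - (1 / (x.2 * √c)) • (ContinuousLinearMap.snd ℝ E ℝ).smulRight ξ').prod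
      ((x.2 * √c) • θ.comp (ContinuousLinearMap.fst ℝ E ℝ))
  A

end Riemannian

section Kahler

variable {E : Type*} [NormedAddCommGroup E] [NormedSpace ℝ E]
  {H : Type*} [TopologicalSpace H] (I : ModelWithCorners ℝ E H)
  {N : Type*} [TopologicalSpace N] [ChartedSpace H N] [IsManifold I ∞ N]

/-- The Nijenhuis tensor `[JX, JY] - J[JX, Y] - J[X, JY] - [X, Y]`. -/
def nijenhuis (J : Π x : N, TangentSpace I x →L[ℝ] TangentSpace I x)
    (X Y : Π x : N, TangentSpace I x) (x : N) : TangentSpace I x :=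
  VectorField.mlieBracket I (fun y => J y (X y)) (fun y => J y (Y y)) x
    - J x (VectorField.mlieBracket I (fun y => J y (X y)) Y x)
    - J x (VectorField.mlieBracket I X (fun y => J y (Y y)) x)
    - VectorField.mlieBracket I X Y x

/-- The exterior derivative `dΩ(X, Y, Z)` of the 2-form `Ω(X, Y) = G(JX, Y)`. -/
def dFundamentalForm (G : Π x : N, TangentSpace I x →L[ℝ] TangentSpace I x →L[ℝ] ℝ)
    (J : Π x : N, TangentSpace I x →L[ℝ] TangentSpace I x)
    (X Y Z : Π x : N, TangentSpace I x) (x : N) : ℝ :=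
  mvfderiv I (fun y => G y (J y (Y y)) (Z y)) x (X x)
    - mvfderiv I (fun y => G y (J y (X y)) (Z y)) x (Y x)
    + mvfderiv I (fun y => G y (J y (X y)) (Y y)) x (Z x)
    - G x (J x (VectorField.mlieBracket I X Y x)) (Z x)
    + G x (J x (VectorField.mlieBracket I X Z x)) (Y x)
    - G x (J x (VectorField.mlieBracket I Y Z x)) (X x)

/-- `(G, J)` is a Kähler structure on the open subset `U` of the manifold `N`: `G` is a smooth
Riemannian metric on `U`, `J` is a smooth integrable almost complex structure on `U` for which
`G` is hermitian, and the fundamental form `Ω(X, Y) = G(JX, Y)` is closed on `U`. Tensor fields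
are smooth if they are smooth on smooth vector fields defined on open subsets. -/
structure IsKahlerOn (G : Π x : N, TangentSpace I x →L[ℝ] TangentSpace I x →L[ℝ] ℝ)
    (J : Π x : N, TangentSpace I x →L[ℝ] TangentSpace I x) (U : Set N) : Prop where
  isOpen : IsOpen U
  metric_symm : ∀ x ∈ U, ∀ v w : TangentSpace I x, G x v w = G x w v
  metric_pos : ∀ x ∈ U, ∀ v : TangentSpace I x, v ≠ 0 → 0 < G x v v
  metric_smooth : ∀ (V : Set N) (X Y : Π x : N, TangentSpace I x), IsOpen V → V ⊆ U →
    ContMDiffOn I I.tangent ∞ (T% X) V → ContMDiffOn I I.tangent ∞ (T% Y) V →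
      ContMDiffOn I 𝓘(ℝ, ℝ) ∞ (fun x => G x (X x) (Y x)) V
  J_sq : ∀ x ∈ U, ∀ v : TangentSpace I x, J x (J x v) = -v
  J_smooth : ∀ (V : Set N) (X : Π x : N, TangentSpace I x), IsOpen V → V ⊆ U →
    ContMDiffOn I I.tangent ∞ (T% X) V →
      ContMDiffOn I I.tangent ∞ (T% (fun x => J x (X x))) V
  hermitian : ∀ x ∈ U, ∀ v w : TangentSpace I x, G x (J x v) (J x w) = G x v w
  integrable : ∀ (V : Set N) (X Y : Π x : N, TangentSpace I x), IsOpen V → V ⊆ U →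
    ContMDiffOn I I.tangent ∞ (T% X) V → ContMDiffOn I I.tangent ∞ (T% Y) V →
      ∀ x ∈ V, nijenhuis I J X Y x = 0
  closed : ∀ (V : Set N) (X Y Z : Π x : N, TangentSpace I x), IsOpen V → V ⊆ U →
    ContMDiffOn I I.tangent ∞ (T% X) V → ContMDiffOn I I.tangent ∞ (T% Y) V →
      ContMDiffOn I I.tangent ∞ (T% Z) V →
        ∀ x ∈ V, dFundamentalForm I G J X Y Z x = 0

end Kahler

end SasakiCone

end

/-! In dimension three a unit Killing field has a very rigid covariant derivative. With θ = g(ξ, ·),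
the Koszul formula and the Killing equation give 2 g(D_X ξ, Z) = dθ(X, Z). So Dξ is skew, and it
kills ξ because the bracket of ξ with any field of an orthonormal frame containing ξ is orthogonal
to ξ. Hence Dξ = a r, where r is a right-angle rotation of ξ^⊥ and a is a function (`frameRot` and
`frameTwist` in an orthonormal frame e₀ = ξ, e₁, e₂). The Jacobi identity gives ξ(a) = 0, the flow
of ξ preserves Dξ, and therefore R(X, ξ)ξ = a² (X - θ(X) ξ) (`curvature_eq`). Taking the trace, f =
a² (`ricciFunction_eq`).

Since f > 0, a has no zeros. Exchanging e₁ and e₂ changes the sign of both a and r, so j = -Dξ / √f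
is a global smooth rotation of ξ^⊥, and no orientation has to be chosen beforehand
(`isTransverseComplexStructure`).

Where f = c, the frame can be ordered so that a = -√c. Then j = r, and [e₁, e₂] has ξ-component 2√c.
On the cone the frame F = (ξ/t, e₁/t, e₂/t, √c ∂_t) is orthonormal with J F₀ = F₃ and J F₁ = F₂. Its
brackets, with σ = √c/t, are those of `HasConeBrackets`, and these alone imply Kähler. Integrability
holds because bracketing with F₀ or F₃ acts on F₁, F₂ by a map commuting with J. Closedness rests on
the coefficient 2σ of F₀ in [F₁, F₂], since dΩ(F₁, F₂, F₃) = -2σ + σ + σ. Both identities are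
verified for arbitrary fields, expanded in F. -/

namespace SasakiCone

open VectorField

/-! ### Lie brackets, their action on functions, and their expansion in a family of fields -/

section Calculus

variable {E : Type*} [NormedAddCommGroup E] [NormedSpace ℝ E]
  {H : Type*} [TopologicalSpace H] {I : ModelWithCorners ℝ E H}
  {M : Type*} [TopologicalSpace M] [ChartedSpace H M]

theorem mvfderiv_eventuallyEq {f h : M → ℝ} {p : M} (hfh : f =ᶠ[𝓝 p] h) :
    mvfderiv I f p = mvfderiv I h p := by
  ext v
  simp only [mvfderiv, ContinuousLinearMap.comp_apply]
  rw [hfh.mfderiv_eq]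
  rfl

theorem mvfderiv_of_eventually_const {f : M → ℝ} {a : ℝ} {p : M} (hf : ∀ᶠ q in 𝓝 p, f q = a) :
    mvfderiv I f p = 0 := by
  rw [mvfderiv_eventuallyEq (h := fun _ => a) hf, mvfderiv_const]

theorem mlieBracket_self (X : Π p : M, TangentSpace I p) (p : M) : mlieBracket I X X p = 0 := by
  have h : mlieBracket I X X p = -mlieBracket I X X p := mlieBracket_swap_apply
  have h2 : (2 : ℝ) • mlieBracket I X X p = 0 := by
    rw [two_smul]
    nth_rewrite 1 [h]
    exact neg_add_cancel _
  exact (smul_eq_zero.mp h2).resolve_left two_ne_zero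

variable [IsManifold I ∞ M]

theorem contMDiffOn_mvfderiv_apply {U : Set M} (hU : IsOpen U) {h : M → ℝ}
    (hh : ContMDiffOn I 𝓘(ℝ, ℝ) ∞ h U) {X : Π p : M, TangentSpace I p}
    (hX : ContMDiffOn I I.tangent ∞ (T% X) U) :
    ContMDiffOn I 𝓘(ℝ, ℝ) ∞ (fun q => mvfderiv I h q (X q)) U := by
  have h1 := (hh.contMDiffOn_tangentMapWithin (m := ∞) (by simp) hU.uniqueMDiffOn).comp hX
    (fun q hq => hq)
  have h2 := (contMDiff_snd_tangentBundle_modelSpace ℝ 𝓘(ℝ, ℝ) (n := ∞)).comp_contMDiffOn h1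
  refine h2.congr fun q hq => ?_
  change mfderiv I 𝓘(ℝ, ℝ) h q (X q) = mfderivWithin I 𝓘(ℝ, ℝ) h U q (X q)
  rw [mfderivWithin_of_isOpen hU hq]

variable [CompleteSpace E]

theorem contMDiffOn_mlieBracket {U : Set M} (hU : IsOpen U) {X Y : Π p : M, TangentSpace I p}
    (hX : ContMDiffOn I I.tangent ∞ (T% X) U) (hY : ContMDiffOn I I.tangent ∞ (T% Y) U) :
    ContMDiffOn I I.tangent ∞ (T% (mlieBracket I X Y)) U := by
  have : IsManifold I (minSmoothness ℝ 2) M := by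
    rw [minSmoothness_of_isRCLikeNormedField]
    infer_instance
  have h : IsManifold I (((⊤ : ℕ∞) : WithTop ℕ∞) + 1) M := by simpa
  intro p hp
  refine ContMDiffAt.contMDiffWithinAt ?_
  exact ContMDiffAt.mlieBracket_vectorField (m := ⊤) (n := ⊤)
    (hX.contMDiffAt (hU.mem_nhds hp)) (hY.contMDiffAt (hU.mem_nhds hp)) (by simp)

theorem jacobi {U : Set M} (hU : IsOpen U) {X Y Z : Π p : M, TangentSpace I p}
    (hX : ContMDiffOn I I.tangent ∞ (T% X) U) (hY : ContMDiffOn I I.tangent ∞ (T% Y) U)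
    (hZ : ContMDiffOn I I.tangent ∞ (T% Z) U) {p : M} (hp : p ∈ U) :
    mlieBracket I X (mlieBracket I Y Z) p =
      mlieBracket I (mlieBracket I X Y) Z p + mlieBracket I Y (mlieBracket I X Z) p := by
  have : IsManifold I (minSmoothness ℝ 3) M := by
    rw [minSmoothness_of_isRCLikeNormedField]
    infer_instance
  have hle : minSmoothness ℝ 2 ≤ (∞ : WithTop ℕ∞) := by
    rw [minSmoothness_of_isRCLikeNormedField]
    exact ENat.LEInfty.out
  exact leibniz_identity_mlieBracket_apply ((hX.contMDiffAt (hU.mem_nhds hp)).of_le hle)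
    ((hY.contMDiffAt (hU.mem_nhds hp)).of_le hle) ((hZ.contMDiffAt (hU.mem_nhds hp)).of_le hle)

omit [CompleteSpace E] [IsManifold I ∞ M] in
theorem mdifferentiableAt_of_contMDiffOn {E' : Type*} [NormedAddCommGroup E'] [NormedSpace ℝ E']
    {H' : Type*} [TopologicalSpace H'] {I' : ModelWithCorners ℝ E' H'}
    {M' : Type*} [TopologicalSpace M'] [ChartedSpace H' M'] {U : Set M} (hU : IsOpen U)
    {f : M → M'} (hf : ContMDiffOn I I' ∞ f U) {p : M} (hp : p ∈ U) :
    MDifferentiableAt I I' f p :=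
  (hf.contMDiffAt (hU.mem_nhds hp)).mdifferentiableAt (by simp)

/-- The commutator formula is extracted from the Jacobi identity for X, Y and hZ. By the Leibniz
rule, the terms with first derivatives of h and those with h itself agree on both sides, which
leaves a scalar multiple of Z at p. That scalar vanishes because Z does not. -/
theorem mvfderiv_mlieBracket_of_ne_zero {U : Set M} (hU : IsOpen U) {h : M → ℝ}
    (hh : ContMDiffOn I 𝓘(ℝ, ℝ) ∞ h U) {X Y Z : Π p : M, TangentSpace I p}
    (hX : ContMDiffOn I I.tangent ∞ (T% X) U) (hY : ContMDiffOn I I.tangent ∞ (T% Y) U)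
    (hZ : ContMDiffOn I I.tangent ∞ (T% Z) U) {p : M} (hp : p ∈ U) (hZp : Z p ≠ 0) :
    mvfderiv I h p (mlieBracket I X Y p)
      = mvfderiv I (fun q => mvfderiv I h q (Y q)) p (X p)
        - mvfderiv I (fun q => mvfderiv I h q (X q)) p (Y p) := by
  have hhd : ∀ {q}, q ∈ U → MDifferentiableAt I 𝓘(ℝ, ℝ) h q :=
    fun hq => mdifferentiableAt_of_contMDiffOn hU hh hq
  have key : ∀ {V W : Π p : M, TangentSpace I p}, ContMDiffOn I I.tangent ∞ (T% V) U →
      ContMDiffOn I I.tangent ∞ (T% W) U →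
      mlieBracket I W (mlieBracket I V (h • Z)) p
        = mvfderiv I (fun q => mvfderiv I h q (V q)) p (W p) • Z p
          + mvfderiv I h p (V p) • mlieBracket I W Z p
          + (mvfderiv I h p (W p) • mlieBracket I V Z p
            + h p • mlieBracket I W (mlieBracket I V Z) p) := by
    intro V W hV hW
    have e : mlieBracket I V (h • Z) =ᶠ[𝓝 p]
        (fun q => mvfderiv I h q (V q)) • Z + h • mlieBracket I V Z := by
      filter_upwards [hU.mem_nhds hp] with q hq
      exact mlieBracket_smul_right (hhd hq) (mdifferentiableAt_of_contMDiffOn hU hZ hq)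
    have hVh := contMDiffOn_mvfderiv_apply hU hh hV
    have hVZ := contMDiffOn_mlieBracket hU hV hZ
    rw [Filter.EventuallyEq.mlieBracket_vectorField_eq (Filter.EventuallyEq.refl (𝓝 p) W) e,
      mlieBracket_add_right
        (mdifferentiableAt_of_contMDiffOn hU (hVh.smul_section hZ) hp)
        (mdifferentiableAt_of_contMDiffOn hU (hh.smul_section hVZ) hp),
      mlieBracket_smul_right (mdifferentiableAt_of_contMDiffOn hU hVh hp)
        (mdifferentiableAt_of_contMDiffOn hU hZ hp),
      mlieBracket_smul_right (hhd hp) (mdifferentiableAt_of_contMDiffOn hU hVZ hp)]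
  have hJ := jacobi hU hX hY (hh.smul_section hZ) hp
  have hJ' := jacobi hU hX hY hZ hp
  rw [key hY hX, key hX hY, mlieBracket_smul_right (hhd hp)
    (mdifferentiableAt_of_contMDiffOn hU hZ hp), hJ'] at hJ
  have h0 : (mvfderiv I (fun q => mvfderiv I h q (Y q)) p (X p)
        - mvfderiv I (fun q => mvfderiv I h q (X q)) p (Y p)
        - mvfderiv I h p (mlieBracket I X Y p)) • Z p = 0 := by
    rw [← sub_eq_zero] at hJ
    rw [← hJ]
    module
  have := (smul_eq_zero.mp h0).resolve_right hZp
  linarith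

/-- The Lie bracket of two vector fields acts on functions as their commutator. -/
theorem mvfderiv_mlieBracket {U : Set M} (hU : IsOpen U) {h : M → ℝ}
    (hh : ContMDiffOn I 𝓘(ℝ, ℝ) ∞ h U) {X Y : Π p : M, TangentSpace I p}
    (hX : ContMDiffOn I I.tangent ∞ (T% X) U) (hY : ContMDiffOn I I.tangent ∞ (T% Y) U)
    {p : M} (hp : p ∈ U) :
    mvfderiv I h p (mlieBracket I X Y p)
      = mvfderiv I (fun q => mvfderiv I h q (Y q)) p (X p)
        - mvfderiv I (fun q => mvfderiv I h q (X q)) p (Y p) := by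
  by_cases hv : ∃ v : TangentSpace I p, v ≠ 0
  -- The auxiliary field Z is a local extension of any nonzero tangent vector; if there is none,
  -- both sides are zero.
  · obtain ⟨v, hv⟩ := hv
    obtain ⟨s, hs, hsm⟩ := FiberBundle.exists_contMDiffOn_extend (k := ∞) I E v
    obtain ⟨V, hVs, hV, hpV⟩ := mem_nhds_iff.mp hs
    exact mvfderiv_mlieBracket_of_ne_zero (hU.inter hV) (hh.mono Set.inter_subset_left)
      (hX.mono Set.inter_subset_left) (hY.mono Set.inter_subset_left)
      ((hsm.mono hVs).mono Set.inter_subset_right) ⟨hp, hpV⟩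
      (by rwa [FiberBundle.extend_apply_self])
  · push Not at hv
    rw [hv (mlieBracket I X Y p), hv (X p), hv (Y p)]
    simp

theorem mlieBracket_sum_right {ι : Type*} (s : Finset ι) {f : ι → M → ℝ}
    {F : ι → Π p : M, TangentSpace I p} {X : Π p : M, TangentSpace I p} {p : M}
    (hf : ∀ i, MDifferentiableAt I 𝓘(ℝ, ℝ) (f i) p)
    (hF : ∀ i, MDifferentiableAt I I.tangent (T% (F i)) p) :
    mlieBracket I X (fun q => ∑ i ∈ s, f i q • F i q) p
      = ∑ i ∈ s, (mvfderiv I (f i) p (X p) • F i p + f i p • mlieBracket I X (F i) p) := by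
  classical
  induction s using Finset.induction_on with
  | empty =>
    simp only [Finset.sum_empty]
    exact congrFun (mlieBracket_zero_right (I := I) (W := X)) p
  | insert a s ha ih =>
    have hsum : (fun q => ∑ i ∈ insert a s, f i q • F i q)
        = f a • F a + fun q => ∑ i ∈ s, f i q • F i q := by
      funext q
      simp [Finset.sum_insert ha]
    have hd : MDifferentiableAt I I.tangent (T% (fun q => ∑ i ∈ s, f i q • F i q)) p :=
      MDifferentiableAt.sum_section (t := fun i => f i • F i)
        fun i _ => (hf i).smul_section (hF i)
    rw [hsum, mlieBracket_add_right ((hf a).smul_section (hF a)) hd, ih,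
      mlieBracket_smul_right (hf a) (hF a), Finset.sum_insert ha]

/-- The Lie bracket of two vector fields that are given by their coefficients in a family `F`. -/
theorem mlieBracket_sum_sum {ι : Type*} [Fintype ι] {x y : ι → M → ℝ}
    {F : ι → Π p : M, TangentSpace I p} {p : M}
    (hx : ∀ i, MDifferentiableAt I 𝓘(ℝ, ℝ) (x i) p)
    (hy : ∀ i, MDifferentiableAt I 𝓘(ℝ, ℝ) (y i) p)
    (hF : ∀ i, MDifferentiableAt I I.tangent (T% (F i)) p) :
    mlieBracket I (fun q => ∑ i, x i q • F i q) (fun q => ∑ i, y i q • F i q) p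
      = ∑ k, (mvfderiv I (y k) p (∑ i, x i p • F i p)
          - mvfderiv I (x k) p (∑ i, y i p • F i p)) • F k p
        + ∑ i, ∑ j, (x i p * y j p) • mlieBracket I (F i) (F j) p := by
  rw [mlieBracket_sum_right _ hy hF]
  have h : ∀ j, mlieBracket I (fun q => ∑ i, x i q • F i q) (F j) p
      = ∑ i, (- mvfderiv I (x i) p (F j p) • F i p + x i p • mlieBracket I (F i) (F j) p) := by
    intro j
    rw [mlieBracket_swap_apply, mlieBracket_sum_right _ hx hF, ← Finset.sum_neg_distrib]
    refine Finset.sum_congr rfl fun i _ => ?_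
    rw [mlieBracket_swap_apply (V := F i)]
    module
  simp only [h, Finset.sum_add_distrib, sub_smul, Finset.sum_sub_distrib, smul_add, mul_smul,
    Finset.smul_sum, map_sum, map_smul, smul_eq_mul, Finset.sum_smul]
  rw [Finset.sum_comm (f := fun j i => y j p • -(mvfderiv I (x i) p) (F j p) • F i p),
    Finset.sum_comm (f := fun j i => y j p • x i p • mlieBracket I (F i) (F j) p)]
  simp only [smul_comm (y _ p) (x _ p), neg_smul, smul_neg, Finset.sum_neg_distrib]
  abel

end Calculus

/-! ### Smooth inner products and local orthonormal frames -/

section Metric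

variable {E : Type*} [NormedAddCommGroup E] [NormedSpace ℝ E]
  {H : Type*} [TopologicalSpace H] {I : ModelWithCorners ℝ E H}
  {M : Type*} [TopologicalSpace M] [ChartedSpace H M] [IsManifold I ∞ M]
  (g : Bundle.ContMDiffRiemannianMetric I ∞ E (fun p : M => TangentSpace I p))

/-- The fields are taken along a map b into M, and not only on M, so that the lemma also applies
along the projection of M × ℝ, as the smoothness of the cone metric requires. -/
theorem contMDiffOn_inner {E' : Type*} [NormedAddCommGroup E'] [NormedSpace ℝ E']
    {H' : Type*} [TopologicalSpace H'] {I' : ModelWithCorners ℝ E' H'}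
    {N : Type*} [TopologicalSpace N] [ChartedSpace H' N] {b : N → M} {U : Set N}
    {X Y : Π x : N, TangentSpace I (b x)}
    (hX : ContMDiffOn I' I.tangent ∞ (fun x => (⟨b x, X x⟩ : TangentBundle I M)) U)
    (hY : ContMDiffOn I' I.tangent ∞ (fun x => (⟨b x, Y x⟩ : TangentBundle I M)) U) :
    ContMDiffOn I' 𝓘(ℝ, ℝ) ∞ (fun x => g.inner (b x) (X x) (Y x)) U := by
  intro x hx
  have hb : ContMDiffWithinAt I' I ∞ b U x :=
    (Bundle.contMDiffWithinAt_totalSpace.mp (hX x hx)).1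
  have h : ContMDiffWithinAt I' (I.prod 𝓘(ℝ)) ∞
      (fun m => Bundle.TotalSpace.mk' ℝ (E := Bundle.Trivial M ℝ) (b m)
        (g.inner (b m) (X m) (Y m))) U x := by
    apply ContMDiffWithinAt.clm_bundle_apply₂ (F₁ := E) (F₂ := E)
    · exact ContMDiffAt.comp_contMDiffWithinAt x g.contMDiff.contMDiffAt hb
    · exact hX x hx
    · exact hY x hx
  exact (Bundle.contMDiffWithinAt_totalSpace.mp h).2

theorem mdifferentiableAt_inner {X Y : Π p : M, TangentSpace I p} {p : M}
    (hX : MDifferentiableAt I I.tangent (T% X) p) (hY : MDifferentiableAt I I.tangent (T% Y) p) :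
    MDifferentiableAt I 𝓘(ℝ, ℝ) (fun q => g.inner q (X q) (Y q)) p := by
  have h : MDifferentiableAt I (I.prod 𝓘(ℝ))
      (fun m => Bundle.TotalSpace.mk' ℝ (E := Bundle.Trivial M ℝ) m
        (g.inner m (X m) (Y m))) p := by
    apply MDifferentiableAt.clm_bundle_apply₂ (F₁ := E) (F₂ := E)
    · exact g.contMDiff.mdifferentiableAt (by simp)
    · exact hX
    · exact hY
  exact ((mdifferentiableAt_totalSpace _ _).mp h).2

variable {g} in
theorem eq_of_forall_inner {p : M} {v w : TangentSpace I p}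
    (h : ∀ u : TangentSpace I p, g.inner p v u = g.inner p w u) : v = w := by
  by_contra hne
  have hpos := g.pos p (v - w) (sub_ne_zero.mpr hne)
  have h0 : g.inner p (v - w) (v - w) = 0 := by
    rw [map_sub (g.inner p) v w, sub_apply, h, sub_self]
  rw [h0] at hpos
  exact lt_irrefl _ hpos

/-- `e` is a smooth orthonormal family of vector fields on the open set `U`. -/
structure IsOrthonormalOn {n : ℕ} (e : Fin n → Π p : M, TangentSpace I p) (U : Set M) : Prop where
  isOpen : IsOpen U
  smooth : ∀ i, ContMDiffOn I I.tangent ∞ (T% (e i)) U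
  inner_eq : ∀ p ∈ U, ∀ i j, g.inner p (e i p) (e j p) = if i = j then 1 else 0

variable {g}

namespace IsOrthonormalOn

variable {n : ℕ} {e : Fin n → Π p : M, TangentSpace I p} {U : Set M}

theorem inner_sum_left (h : IsOrthonormalOn g e U) {p : M} (hp : p ∈ U) (a : Fin n → ℝ)
    (j : Fin n) : g.inner p (∑ i, a i • e i p) (e j p) = a j := by
  simp [map_sum, h.inner_eq p hp]

theorem linearIndependent (h : IsOrthonormalOn g e U) {p : M} (hp : p ∈ U) :
    LinearIndependent ℝ (fun i => e i p) := by
  rw [Fintype.linearIndependent_iff]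
  intro a ha i
  rw [← h.inner_sum_left hp a i, ha]
  simp

theorem mono (h : IsOrthonormalOn g e U) {V : Set M} (hV : IsOpen V) (hVU : V ⊆ U) :
    IsOrthonormalOn g e V :=
  ⟨hV, fun i => (h.smooth i).mono hVU, fun p hp => h.inner_eq p (hVU hp)⟩

theorem expand [FiniteDimensional ℝ E] (h : IsOrthonormalOn g e U)
    (hn : Module.finrank ℝ E = n) {p : M} (hp : p ∈ U) (v : TangentSpace I p) :
    v = ∑ i, g.inner p v (e i p) • e i p := by
  have : FiniteDimensional ℝ (TangentSpace I p) := inferInstanceAs (FiniteDimensional ℝ E)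
  have hspan : Submodule.span ℝ (Set.range fun i => e i p) = ⊤ :=
    (h.linearIndependent hp).span_eq_top_of_card_eq_finrank' ((Fintype.card_fin n).trans hn.symm)
  have hv : v ∈ Submodule.span ℝ (Set.range fun i => e i p) := hspan ▸ Submodule.mem_top
  obtain ⟨a, rfl⟩ := (Submodule.mem_span_range_iff_exists_fun ℝ).mp hv
  simp_rw [h.inner_sum_left hp]

/-- One Gram-Schmidt step: a smooth orthonormal family that is not a frame can be enlarged near
every point. -/
theorem exists_snoc [FiniteDimensional ℝ E] (h : IsOrthonormalOn g e U)
    (hn : n < Module.finrank ℝ E) {p : M} (hp : p ∈ U) :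
    ∃ (X : Π p : M, TangentSpace I p) (V : Set M), p ∈ V ∧ V ⊆ U ∧
      IsOrthonormalOn g (Fin.snoc (α := fun _ => Π p : M, TangentSpace I p) e X) V := by
  have : FiniteDimensional ℝ (TangentSpace I p) := inferInstanceAs (FiniteDimensional ℝ E)
  obtain ⟨v, hv⟩ : ∃ v : TangentSpace I p, v ∉ Submodule.span ℝ (Set.range fun i => e i p) := by
    by_contra! hall
    have htop : Submodule.span ℝ (Set.range fun i => e i p) = ⊤ :=
      eq_top_iff.mpr fun x _ => hall x
    have h1 := finrank_range_le_card (R := ℝ) (fun i => e i p)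
    rw [Set.finrank, htop, finrank_top, Fintype.card_fin] at h1
    exact absurd hn (not_lt.mpr h1)
  obtain ⟨s, hs, hsm⟩ := FiberBundle.exists_contMDiffOn_extend (k := ∞) I E v
  obtain ⟨V, hVs, hV, hpV⟩ := mem_nhds_iff.mp (Filter.inter_mem hs (h.isOpen.mem_nhds hp))
  set W : Π q : M, TangentSpace I q := FiberBundle.extend E v with hW
  have hWs : ContMDiffOn I I.tangent ∞ (T% W) V := hsm.mono fun q hq => (hVs hq).1
  have hVU : V ⊆ U := fun q hq => (hVs hq).2
  have hes : ∀ i, ContMDiffOn I I.tangent ∞ (T% (e i)) V := fun i => (h.smooth i).mono hVU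
  set W' : Π q : M, TangentSpace I q :=
    W - fun q => ∑ i, g.inner q (W q) (e i q) • e i q with hW'
  have hW's : ContMDiffOn I I.tangent ∞ (T% W') V :=
    hWs.sub_section (ContMDiffOn.sum_section fun i _ =>
      (contMDiffOn_inner g hWs (hes i)).smul_section (hes i))
  have horth : ∀ q ∈ V, ∀ j, g.inner q (W' q) (e j q) = 0 := by
    intro q hq j
    simp only [hW', Pi.sub_apply, map_sub, sub_apply]
    rw [h.inner_sum_left (hVU hq), sub_self]
  have hnorm := contMDiffOn_inner g hW's hW's
  -- Subtracting the projection leaves something nonzero at p because v was chosen outside the span;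
  -- V' below is where this persists.
  have hW'p : W' p ≠ 0 := by
    intro h0
    have h1 : v = ∑ i, g.inner p (W p) (e i p) • e i p := by
      simpa [hW', sub_eq_zero, hW] using h0
    exact hv (h1 ▸ Submodule.sum_mem _ fun i _ =>
      Submodule.smul_mem _ _ (Submodule.subset_span ⟨i, rfl⟩))
  set V' : Set M := V ∩ (fun q => g.inner q (W' q) (W' q)) ⁻¹' Set.Ioi 0 with hV'
  have hV'o : IsOpen V' := hnorm.continuousOn.isOpen_inter_preimage hV isOpen_Ioi
  have hV'V : V' ⊆ V := Set.inter_subset_left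
  set ν : M → ℝ := fun q => (√(g.inner q (W' q) (W' q)))⁻¹ with hν
  have hνs : ContMDiffOn I 𝓘(ℝ, ℝ) ∞ ν V' := by
    intro q hq
    have hq2 : 0 < g.inner q (W' q) (W' q) := hq.2
    have hc : ContDiffAt ℝ ∞ (fun r : ℝ => (√r)⁻¹) (g.inner q (W' q) (W' q)) :=
      (Real.contDiffAt_sqrt hq2.ne').inv (Real.sqrt_ne_zero'.mpr hq2)
    exact ContMDiffAt.comp_contMDiffWithinAt q (g := fun r : ℝ => (√r)⁻¹) hc.contMDiffAt
      ((hnorm q hq.1).mono hV'V)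
  have hνsq : ∀ q ∈ V', ν q * ν q * g.inner q (W' q) (W' q) = 1 := by
    intro q hq
    have hq2 : 0 < g.inner q (W' q) (W' q) := hq.2
    have := Real.mul_self_sqrt hq2.le
    have h0 := Real.sqrt_ne_zero'.mpr hq2
    simp only [hν]
    field_simp
    nlinarith
  refine ⟨ν • W', V', ⟨hpV, g.pos p _ hW'p⟩, hV'V.trans hVU, hV'o, fun i => ?_, ?_⟩
  · induction i using Fin.lastCases with
    | last =>
      rw [Fin.snoc_last]
      exact hνs.smul_section (hW's.mono hV'V)
    | cast i =>
      rw [Fin.snoc_castSucc]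
      exact (hes i).mono hV'V
  · intro q hq i j
    have hx : ∀ i, g.inner q (ν q • W' q) (e i q) = 0 := fun i => by
      rw [map_smul, smul_apply, horth q hq.1, smul_zero]
    induction i using Fin.lastCases with
    | last =>
      induction j using Fin.lastCases with
      | last =>
        simp only [Fin.snoc_last, Pi.smul_apply', map_smul, smul_apply,
          smul_eq_mul, if_true]
        rw [← hνsq q hq]
        ring
      | cast j =>
        rw [Fin.snoc_last, Fin.snoc_castSucc, if_neg (Fin.castSucc_lt_last j).ne']
        exact hx j
    | cast i =>
      induction j using Fin.lastCases with
      | last =>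
        rw [Fin.snoc_last, Fin.snoc_castSucc, if_neg (Fin.castSucc_lt_last i).ne, g.symm]
        exact hx i
      | cast j =>
        simp only [Fin.snoc_castSucc, h.inner_eq q (hVU hq.1), Fin.castSucc_inj]

end IsOrthonormalOn

/-- A smooth unit vector field on a 3-manifold belongs to a smooth orthonormal frame near every
point. -/
theorem exists_orthonormal_frame [FiniteDimensional ℝ E] (hE : Module.finrank ℝ E = 3)
    {ξ : Π p : M, TangentSpace I p} (hξ : ContMDiff I I.tangent ∞ (T% ξ))
    (hunit : ∀ p, g.inner p (ξ p) (ξ p) = 1) (p : M) :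
    ∃ (e : Fin 3 → Π p : M, TangentSpace I p) (U : Set M), p ∈ U ∧ IsOrthonormalOn g e U ∧
      e 0 = ξ := by
  have h1 : IsOrthonormalOn g (fun _ : Fin 1 => ξ) Set.univ :=
    ⟨isOpen_univ, fun _ => hξ.contMDiffOn, fun q _ i j => by
      rw [if_pos (Subsingleton.elim i j), hunit]⟩
  obtain ⟨X, V, hpV, -, h2⟩ := h1.exists_snoc (by omega) (Set.mem_univ p)
  obtain ⟨Y, V', hpV', -, h3⟩ := h2.exists_snoc (by omega) hpV
  exact ⟨_, V', hpV', h3, rfl⟩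

end Metric

/-! ### The covariant derivative of a unit Killing field in an adapted frame -/

noncomputable section LeviCivita

variable {E : Type*} [NormedAddCommGroup E] [NormedSpace ℝ E]
  {H : Type*} [TopologicalSpace H] {I : ModelWithCorners ℝ E H}
  {M : Type*} [TopologicalSpace M] [ChartedSpace H M] [IsManifold I ∞ M]
  {g : Bundle.ContMDiffRiemannianMetric I ∞ E (fun p : M => TangentSpace I p)}

/-- Every tangent vector is the value of a differentiable field, so nondegeneracy of g makes a
solution of the Koszul formula unique. Existence is never needed in general: besides D_X 0, only D_X
ξ and D_ξ Y occur, and for these explicit solutions are exhibited. -/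
theorem leviCivita_eq {X Y : Π p : M, TangentSpace I p} {p : M} {w : TangentSpace I p}
    (hw : ∀ Z : Π q : M, TangentSpace I q, MDifferentiableAt I I.tangent (T% Z) p →
      2 * g.inner p w (Z p) = koszul g X Y Z p) : leviCivita g X Y p = w := by
  have h := Classical.epsilon_spec (p := fun w : TangentSpace I p =>
    ∀ Z : Π q : M, TangentSpace I q, MDifferentiableAt I I.tangent (T% Z) p →
      2 * g.inner p w (Z p) = koszul g X Y Z p) ⟨w, hw⟩
  refine eq_of_forall_inner (g := g) fun u => ?_
  have hd : MDifferentiableAt I I.tangent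
      (T% (FiberBundle.extend E u : Π q : M, TangentSpace I q)) p :=
    FiberBundle.mdifferentiableAt_extend I E u
  have h1 := (h _ hd).trans (hw _ hd).symm
  rw [FiberBundle.extend_apply_self] at h1
  exact mul_left_cancel₀ two_ne_zero h1

theorem leviCivita_congr {X X' Y Y' : Π p : M, TangentSpace I p} {p : M} (hX : X =ᶠ[𝓝 p] X')
    (hY : Y =ᶠ[𝓝 p] Y') : leviCivita g X Y p = leviCivita g X' Y' p := by
  have h : ∀ Z : Π q : M, TangentSpace I q, koszul g X Y Z p = koszul g X' Y' Z p := by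
    intro Z
    have hZ := Filter.EventuallyEq.refl (𝓝 p) Z
    have e1 : (fun q => g.inner q (Y q) (Z q)) =ᶠ[𝓝 p] fun q => g.inner q (Y' q) (Z q) := by
      filter_upwards [hY] with q hq using by rw [hq]
    have e2 : (fun q => g.inner q (X q) (Z q)) =ᶠ[𝓝 p] fun q => g.inner q (X' q) (Z q) := by
      filter_upwards [hX] with q hq using by rw [hq]
    have e3 : (fun q => g.inner q (X q) (Y q)) =ᶠ[𝓝 p] fun q => g.inner q (X' q) (Y' q) := by
      filter_upwards [hX, hY] with q hq hq' using by rw [hq, hq']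
    simp only [koszul]
    rw [mvfderiv_eventuallyEq e1, mvfderiv_eventuallyEq e2, mvfderiv_eventuallyEq e3,
      hX.mlieBracket_vectorField_eq hY, hX.mlieBracket_vectorField_eq hZ,
      hY.mlieBracket_vectorField_eq hZ, hX.eq_of_nhds, hY.eq_of_nhds]
  simp only [leviCivita, h]

theorem leviCivita_zero_right (X : Π p : M, TangentSpace I p) (p : M) :
    leviCivita g X (0 : Π p : M, TangentSpace I p) p = 0 := by
  refine leviCivita_eq fun Z _ => ?_
  have h1 : mlieBracket I X 0 p = 0 :=
    congrFun (mlieBracket_zero_right (I := I) (W := X)) p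
  have h2 : mlieBracket I 0 Z p = 0 :=
    congrFun (mlieBracket_zero_left (I := I) (W := Z)) p
  simp only [koszul, h1, h2, Pi.zero_apply, map_zero, zero_apply, mvfderiv_const]
  simp

/-- Half of the `ξ`-component of `[e₂, e₁]`, for an orthonormal frame `e` with `e₀ = ξ`. -/
def frameTwist (g : Bundle.ContMDiffRiemannianMetric I ∞ E (fun p : M => TangentSpace I p))
    (e : Fin 3 → Π p : M, TangentSpace I p) (p : M) : ℝ :=
  -(1 / 2) * g.inner p (mlieBracket I (e 1) (e 2) p) (e 0 p)

/-- The `e₂`-component of `[e₀, e₁]` for an orthonormal frame `e`. -/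
def frameSpin (g : Bundle.ContMDiffRiemannianMetric I ∞ E (fun p : M => TangentSpace I p))
    (e : Fin 3 → Π p : M, TangentSpace I p) (p : M) : ℝ :=
  g.inner p (mlieBracket I (e 0) (e 1) p) (e 2 p)

/-- The rotation `e₁ ↦ e₂ ↦ -e₁`, `e₀ ↦ 0` for an orthonormal frame `e`. -/
def frameRot (g : Bundle.ContMDiffRiemannianMetric I ∞ E (fun p : M => TangentSpace I p))
    (e : Fin 3 → Π p : M, TangentSpace I p) (p : M) : TangentSpace I p →L[ℝ] TangentSpace I p :=
  (g.inner p (e 1 p)).smulRight (e 2 p) - (g.inner p (e 2 p)).smulRight (e 1 p)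

theorem frameRot_apply (e : Fin 3 → Π p : M, TangentSpace I p) (p : M) (v : TangentSpace I p) :
    frameRot g e p v = g.inner p v (e 1 p) • e 2 p - g.inner p v (e 2 p) • e 1 p := by
  rw [g.symm p v, g.symm p v]
  rfl

namespace IsOrthonormalOn

variable [FiniteDimensional ℝ E] {e : Fin 3 → Π p : M, TangentSpace I p} {U : Set M}

theorem eventuallyEq_sum {n : ℕ} {e : Fin n → Π p : M, TangentSpace I p}
    (h : IsOrthonormalOn g e U) (hE : Module.finrank ℝ E = n) {p : M} (hp : p ∈ U)
    (X : Π p : M, TangentSpace I p) :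
    X =ᶠ[𝓝 p] fun q => ∑ i, g.inner q (X q) (e i q) • e i q := by
  filter_upwards [h.isOpen.mem_nhds hp] with q hq using h.expand hE hq (X q)

omit [FiniteDimensional ℝ E] in
theorem mdifferentiableAt {n : ℕ} {e : Fin n → Π p : M, TangentSpace I p}
    (h : IsOrthonormalOn g e U) {p : M} (hp : p ∈ U) (i : Fin n) :
    MDifferentiableAt I I.tangent (T% (e i)) p :=
  mdifferentiableAt_of_contMDiffOn h.isOpen (h.smooth i) hp

/-- The Lie bracket in terms of the coefficients in an orthonormal frame. -/
theorem mlieBracket_eq {n : ℕ} {e : Fin n → Π p : M, TangentSpace I p}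
    (h : IsOrthonormalOn g e U) (hE : Module.finrank ℝ E = n) {X Y : Π p : M, TangentSpace I p}
    {p : M} (hp : p ∈ U) (hX : MDifferentiableAt I I.tangent (T% X) p)
    (hY : MDifferentiableAt I I.tangent (T% Y) p) :
    mlieBracket I X Y p
      = ∑ k, (mvfderiv I (fun q => g.inner q (Y q) (e k q)) p (X p)
          - mvfderiv I (fun q => g.inner q (X q) (e k q)) p (Y p)) • e k p
        + ∑ i, ∑ j, (g.inner p (X p) (e i p) * g.inner p (Y p) (e j p))
          • mlieBracket I (e i) (e j) p := by
  have : CompleteSpace E := FiniteDimensional.complete ℝ E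
  have hd := h.mdifferentiableAt hp
  refine ((h.eventuallyEq_sum hE hp X).mlieBracket_vectorField_eq
    (h.eventuallyEq_sum hE hp Y)).trans ((mlieBracket_sum_sum
      (fun i => mdifferentiableAt_inner g hX (hd i))
      (fun i => mdifferentiableAt_inner g hY (hd i)) hd).trans ?_)
  rw [← h.expand hE hp (X p), ← h.expand hE hp (Y p)]

omit [FiniteDimensional ℝ E] in
-- The inner products of frame fields are constant, so the left side of the Killing equation
-- vanishes. With one index 0 this says that [ξ, eᵢ] is orthogonal to ξ.
theorem inner_bracket_skew (h : IsOrthonormalOn g e U) (hkill : IsKilling g (e 0)) {p : M}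
    (hp : p ∈ U) (i j : Fin 3) :
    g.inner p (mlieBracket I (e 0) (e i) p) (e j p)
      = - g.inner p (mlieBracket I (e 0) (e j) p) (e i p) := by
  have hk := hkill p (e i) (e j) (h.mdifferentiableAt hp i) (h.mdifferentiableAt hp j)
  rw [mvfderiv_of_eventually_const (a := if i = j then 1 else 0)
    (by filter_upwards [h.isOpen.mem_nhds hp] with q hq using h.inner_eq q hq i j),
    g.symm p (e i p)] at hk
  simp only [zero_apply] at hk
  linarith

/-- Bracketing with ξ is skew in the frame and kills ξ, so it acts on ξ^⊥ as a multiple of the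
rotation. The multiple is `frameSpin`; the next lemma has the same one with the opposite sign. -/
theorem bracket_zero_one (h : IsOrthonormalOn g e U) (hE : Module.finrank ℝ E = 3)
    (hkill : IsKilling g (e 0)) {p : M} (hp : p ∈ U) :
    mlieBracket I (e 0) (e 1) p = frameSpin g e p • e 2 p := by
  rw [h.expand hE hp (mlieBracket I (e 0) (e 1) p), Fin.sum_univ_three,
    h.inner_bracket_skew hkill hp 1 0, mlieBracket_self]
  have h1 := h.inner_bracket_skew hkill hp 1 1
  have h2 : g.inner p (mlieBracket I (e 0) (e 1) p) (e 1 p) = 0 := by linarith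
  rw [h2, frameSpin]
  simp

theorem bracket_zero_two (h : IsOrthonormalOn g e U) (hE : Module.finrank ℝ E = 3)
    (hkill : IsKilling g (e 0)) {p : M} (hp : p ∈ U) :
    mlieBracket I (e 0) (e 2) p = -(frameSpin g e p • e 1 p) := by
  rw [h.expand hE hp (mlieBracket I (e 0) (e 2) p), Fin.sum_univ_three,
    h.inner_bracket_skew hkill hp 2 0, mlieBracket_self, h.inner_bracket_skew hkill hp 2 1]
  have h1 := h.inner_bracket_skew hkill hp 2 2
  have h2 : g.inner p (mlieBracket I (e 0) (e 2) p) (e 2 p) = 0 := by linarith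
  rw [h2, frameSpin]
  simp

/-- The exterior derivative of the 1-form `g(e₀, ·)`. -/
theorem exteriorDeriv_eq (h : IsOrthonormalOn g e U) (hE : Module.finrank ℝ E = 3)
    (hkill : IsKilling g (e 0)) {X Y : Π p : M, TangentSpace I p} {p : M} (hp : p ∈ U)
    (hX : MDifferentiableAt I I.tangent (T% X) p) (hY : MDifferentiableAt I I.tangent (T% Y) p) :
    mvfderiv I (fun q => g.inner q (Y q) (e 0 q)) p (X p)
        - mvfderiv I (fun q => g.inner q (X q) (e 0 q)) p (Y p)
        - g.inner p (mlieBracket I X Y p) (e 0 p)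
      = 2 * g.inner p (frameTwist g e p • frameRot g e p (X p)) (Y p) := by
  rw [h.mlieBracket_eq hE hp hX hY]
  -- With θ([e₀, eᵢ]) = 0, the only component of dθ that survives is dθ(e₁, e₂) = -θ([e₁, e₂]),
  -- which is twice the twist.
  have h00 : ∀ i, g.inner p (mlieBracket I (e 0) (e i) p) (e 0 p) = 0 := by
    intro i
    rw [h.inner_bracket_skew hkill hp, mlieBracket_self]
    simp
  have h00' : ∀ i, g.inner p (mlieBracket I (e i) (e 0) p) (e 0 p) = 0 := by
    intro i
    rw [mlieBracket_swap_apply, map_neg, neg_apply, h00, neg_zero]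
  have h21 : g.inner p (mlieBracket I (e 2) (e 1) p) (e 0 p)
      = - g.inner p (mlieBracket I (e 1) (e 2) p) (e 0 p) := by
    rw [mlieBracket_swap_apply, map_neg, neg_apply]
  have h12 : g.inner p (mlieBracket I (e 1) (e 2) p) (e 0 p) = -2 * frameTwist g e p := by
    rw [frameTwist]
    ring
  rw [map_add, add_apply, h.inner_sum_left hp]
  simp only [Fin.sum_univ_three, mlieBracket_self, map_add, map_smul, add_apply, smul_apply,
    h00, h00', h21, h12, smul_zero, smul_eq_mul, frameRot_apply, map_sub, sub_apply, map_zero,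
    zero_apply]
  rw [g.symm p (e 2 p), g.symm p (e 1 p)]
  ring

/-- The Killing equation cancels the derivative along ξ in the Koszul formula against two of the
bracket terms; what remains is dθ(X, Z). -/
theorem leviCivita_left (h : IsOrthonormalOn g e U) (hE : Module.finrank ℝ E = 3)
    (hkill : IsKilling g (e 0)) {X : Π p : M, TangentSpace I p} {p : M} (hp : p ∈ U)
    (hX : MDifferentiableAt I I.tangent (T% X) p) :
    leviCivita g X (e 0) p = frameTwist g e p • frameRot g e p (X p) := by
  refine leviCivita_eq fun Z hZ => ?_
  rw [← h.exteriorDeriv_eq hE hkill hp hX hZ, koszul, hkill p X Z hX hZ,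
    mlieBracket_swap_apply (V := X) (W := e 0), map_neg, neg_apply,
    g.symm p (mlieBracket I (e 0) Z p)]
  simp only [g.symm _ (e 0 _)]
  ring

/-- This is D_ξ Y = [ξ, Y] + D_Y ξ, that is, vanishing torsion, again obtained from the Koszul
formula: the Killing equation turns it into 2 g([ξ, Y], Z) + dθ(Y, Z). -/
theorem leviCivita_right (h : IsOrthonormalOn g e U) (hE : Module.finrank ℝ E = 3)
    (hkill : IsKilling g (e 0)) {Y : Π p : M, TangentSpace I p} {p : M} (hp : p ∈ U)
    (hY : MDifferentiableAt I I.tangent (T% Y) p) :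
    leviCivita g (e 0) Y p
      = mlieBracket I (e 0) Y p + frameTwist g e p • frameRot g e p (Y p) := by
  refine leviCivita_eq fun Z hZ => ?_
  rw [map_add, add_apply, mul_add, ← h.exteriorDeriv_eq hE hkill hp hY hZ, koszul,
    hkill p Y Z hY hZ, g.symm p (mlieBracket I (e 0) Z p)]
  simp only [g.symm _ (e 0 _)]
  ring

omit [FiniteDimensional ℝ E] in
theorem contMDiffOn_frameTwist [CompleteSpace E] (h : IsOrthonormalOn g e U) :
    ContMDiffOn I 𝓘(ℝ, ℝ) ∞ (frameTwist g e) U := by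
  have h1 : ContMDiffOn I 𝓘(ℝ, ℝ) ∞ (fun _ : M => -(1 / 2 : ℝ)) U := contMDiffOn_const
  exact h1.smul (contMDiffOn_inner g
    (contMDiffOn_mlieBracket h.isOpen (h.smooth 1) (h.smooth 2)) (h.smooth 0))

omit [FiniteDimensional ℝ E] in
theorem contMDiffOn_frameSpin [CompleteSpace E] (h : IsOrthonormalOn g e U) :
    ContMDiffOn I 𝓘(ℝ, ℝ) ∞ (frameSpin g e) U :=
  contMDiffOn_inner g (contMDiffOn_mlieBracket h.isOpen (h.smooth 0) (h.smooth 1)) (h.smooth 2)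

/-- The twist is constant along `e₀`, by the Jacobi identity. -/
theorem mvfderiv_frameTwist (h : IsOrthonormalOn g e U) (hE : Module.finrank ℝ E = 3)
    (hkill : IsKilling g (e 0)) {p : M} (hp : p ∈ U) :
    mvfderiv I (frameTwist g e) p (e 0 p) = 0 := by
  have : CompleteSpace E := FiniteDimensional.complete ℝ E
  have hU := h.isOpen
  have hd := h.mdifferentiableAt hp
  have hB := contMDiffOn_mlieBracket hU (h.smooth 1) (h.smooth 2)
  have hs := mdifferentiableAt_of_contMDiffOn hU h.contMDiffOn_frameSpin hp
  have e1 : mlieBracket I (e 0) (e 1) =ᶠ[𝓝 p] frameSpin g e • e 2 := by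
    filter_upwards [hU.mem_nhds hp] with q hq using h.bracket_zero_one hE hkill hq
  have e2 : mlieBracket I (e 0) (e 2) =ᶠ[𝓝 p] (-frameSpin g e) • e 1 := by
    filter_upwards [hU.mem_nhds hp] with q hq
    exact (h.bracket_zero_two hE hkill hq).trans (neg_smul _ _).symm
  -- By Jacobi the double bracket is [s e₂, e₂] + [e₁, -s e₁] with s the spin. Both terms are
  -- derivatives of s times e₁ or e₂, hence orthogonal to e₀.
  have hJ : g.inner p (mlieBracket I (e 0) (mlieBracket I (e 1) (e 2)) p) (e 0 p) = 0 := by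
    rw [jacobi hU (h.smooth 0) (h.smooth 1) (h.smooth 2) hp,
      e1.mlieBracket_vectorField_eq (Filter.EventuallyEq.refl (𝓝 p) (e 2)),
      (Filter.EventuallyEq.refl (𝓝 p) (e 1)).mlieBracket_vectorField_eq e2,
      mlieBracket_smul_left hs (hd 2), mlieBracket_smul_right hs.neg (hd 1),
      mlieBracket_self, mlieBracket_self]
    simp [h.inner_eq p hp]
  have hk := hkill p _ (e 0) (mdifferentiableAt_of_contMDiffOn hU hB hp) (hd 0)
  rw [hJ, mlieBracket_self, map_zero, add_zero] at hk
  have hsm : frameTwist g e = (fun _ : M => -(1 / 2 : ℝ)) •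
      fun q : M => g.inner q (mlieBracket I (e 1) (e 2) q) (e 0 q) := rfl
  rw [hsm, mvfderiv_smul mdifferentiableAt_const (mdifferentiableAt_inner g
    (mdifferentiableAt_of_contMDiffOn hU hB hp) (hd 0)), mvfderiv_const]
  simp [hk]

end IsOrthonormalOn

end LeviCivita

/-! ### The curvature along ξ is the square of the twist -/

noncomputable section Curvature

variable {E : Type*} [NormedAddCommGroup E] [NormedSpace ℝ E] [FiniteDimensional ℝ E]
  {H : Type*} [TopologicalSpace H] {I : ModelWithCorners ℝ E H}
  {M : Type*} [TopologicalSpace M] [ChartedSpace H M] [IsManifold I ∞ M]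
  {g : Bundle.ContMDiffRiemannianMetric I ∞ E (fun p : M => TangentSpace I p)}

namespace IsOrthonormalOn

variable {e : Fin 3 → Π p : M, TangentSpace I p} {U : Set M}

omit [FiniteDimensional ℝ E] in
theorem frameRot_zero (h : IsOrthonormalOn g e U) {p : M} (hp : p ∈ U) :
    frameRot g e p (e 0 p) = 0 := by
  simp [frameRot_apply, h.inner_eq p hp]

omit [FiniteDimensional ℝ E] in
theorem frameRot_one (h : IsOrthonormalOn g e U) {p : M} (hp : p ∈ U) :
    frameRot g e p (e 1 p) = e 2 p := by
  simp [frameRot_apply, h.inner_eq p hp]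

omit [FiniteDimensional ℝ E] in
theorem frameRot_two (h : IsOrthonormalOn g e U) {p : M} (hp : p ∈ U) :
    frameRot g e p (e 2 p) = -e 1 p := by
  simp [frameRot_apply, h.inner_eq p hp]

/-- The term D_X D_ξ ξ vanishes. Writing B = a r for Dξ, the other two give -[ξ, BX] - B(BX) + B[ξ,
X]. The brackets cancel because the flow of ξ preserves B: ξ(a) = 0, and the spin terms commute with
r. What is left is -B²X, which is a² times the part of X orthogonal to ξ. -/
theorem curvature_eq (h : IsOrthonormalOn g e U) (hE : Module.finrank ℝ E = 3)
    (hkill : IsKilling g (e 0)) {X : Π p : M, TangentSpace I p} {V : Set M} (hV : IsOpen V)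
    (hX : ContMDiffOn I I.tangent ∞ (T% X) V) {p : M} (hp : p ∈ U) (hpV : p ∈ V) :
    curvature g X (e 0) (e 0) p
      = frameTwist g e p ^ 2 • (X p - g.inner p (X p) (e 0 p) • e 0 p) := by
  have : CompleteSpace E := FiniteDimensional.complete ℝ E
  have hU := h.isOpen
  have hd := h.mdifferentiableAt hp
  have hXp := mdifferentiableAt_of_contMDiffOn hV hX hpV
  have ha := mdifferentiableAt_of_contMDiffOn hU h.contMDiffOn_frameTwist hp
  have hx : ∀ i, MDifferentiableAt I 𝓘(ℝ, ℝ) (fun q => g.inner q (X q) (e i q)) p :=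
    fun i => mdifferentiableAt_inner g hXp (hd i)
  have e0 : leviCivita g (e 0) (e 0) =ᶠ[𝓝 p] (0 : Π q : M, TangentSpace I q) := by
    filter_upwards [hU.mem_nhds hp] with q hq
    rw [h.leviCivita_left hE hkill hq (h.mdifferentiableAt hq 0), h.frameRot_zero hq, smul_zero]
    rfl
  -- u and v are the coefficients of D_X ξ along e₂ and e₁.
  set u : M → ℝ := frameTwist g e * fun q => g.inner q (X q) (e 1 q) with hu
  set v : M → ℝ := frameTwist g e * -fun q => g.inner q (X q) (e 2 q) with hv
  have hud : MDifferentiableAt I 𝓘(ℝ, ℝ) u p := ha.mul (hx 1)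
  have hvd : MDifferentiableAt I 𝓘(ℝ, ℝ) v p := ha.mul (hx 2).neg
  have e1 : leviCivita g X (e 0) =ᶠ[𝓝 p] u • e 2 + v • e 1 := by
    filter_upwards [hU.mem_nhds hp, hV.mem_nhds hpV] with q hq hqV
    rw [h.leviCivita_left hE hkill hq (mdifferentiableAt_of_contMDiffOn hV hX hqV),
      frameRot_apply]
    change _ = (frameTwist g e q * g.inner q (X q) (e 1 q)) • e 2 q
      + (frameTwist g e q * -g.inner q (X q) (e 2 q)) • e 1 q
    module
  have hd1 := MDifferentiableAt.smul_section hud (hd 2)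
  have hd2 := MDifferentiableAt.smul_section hvd (hd 1)
  have hBX : MDifferentiableAt I I.tangent (T% (mlieBracket I X (e 0))) p :=
    mdifferentiableAt_of_contMDiffOn (hU.inter hV)
      (contMDiffOn_mlieBracket (hU.inter hV) (hX.mono Set.inter_subset_right)
        ((h.smooth 0).mono Set.inter_subset_left)) ⟨hp, hpV⟩
  have hu' : mvfderiv I u p (e 0 p) = frameTwist g e p *
      mvfderiv I (fun q => g.inner q (X q) (e 1 q)) p (e 0 p) := by
    rw [hu, mvfderiv_mul ha (hx 1)]
    simp [h.mvfderiv_frameTwist hE hkill hp]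
  have hv' : mvfderiv I v p (e 0 p) = -(frameTwist g e p *
      mvfderiv I (fun q => g.inner q (X q) (e 2 q)) p (e 0 p)) := by
    rw [hv, mvfderiv_mul ha (hx 2).neg]
    simp [h.mvfderiv_frameTwist hE hkill hp, mvfderiv_neg]
  have hBX' : mlieBracket I X (e 0) p = -∑ i,
      (mvfderiv I (fun q => g.inner q (X q) (e i q)) p (e 0 p) • e i p
        + g.inner p (X p) (e i p) • mlieBracket I (e 0) (e i) p) := by
    rw [mlieBracket_swap_apply, ← mlieBracket_sum_right _ hx hd]
    exact congrArg _ ((Filter.EventuallyEq.refl (𝓝 p) (e 0)).mlieBracket_vectorField_eq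
      (h.eventuallyEq_sum hE hp X))
  rw [curvature, leviCivita_congr (Filter.EventuallyEq.refl (𝓝 p) X) e0, leviCivita_zero_right,
    leviCivita_congr (Filter.EventuallyEq.refl (𝓝 p) (e 0)) e1,
    h.leviCivita_right hE hkill hp (mdifferentiableAt_add_section hd1 hd2),
    h.leviCivita_left hE hkill hp hBX,
    mlieBracket_add_right hd1 hd2, mlieBracket_smul_right hud (hd 2),
    mlieBracket_smul_right hvd (hd 1), hBX', hu', hv']
  conv_rhs => rw [h.expand hE hp (X p)]
  simp only [Fin.sum_univ_three, mlieBracket_self, h.bracket_zero_one hE hkill hp,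
    h.bracket_zero_two hE hkill hp, Pi.add_apply, Pi.smul_apply', map_add, map_neg, map_smul,
    h.frameRot_zero hp, h.frameRot_one hp, h.frameRot_two hp, hu, hv, Pi.mul_apply, add_apply,
    smul_apply, h.inner_eq p hp]
  simp
  module

/-- The endomorphism X ↦ R(X, ξ)ξ is a² times a projection of rank two, and the normalization
divides its trace by n - 1 = 2. -/
theorem ricciFunction_eq (h : IsOrthonormalOn g e U) (hE : Module.finrank ℝ E = 3)
    (hkill : IsKilling g (e 0)) {p : M} (hp : p ∈ U) :
    ricciFunction g (e 0) p = frameTwist g e p ^ 2 := by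
  set b : Module.Basis _ ℝ (TangentSpace I p) := Module.finBasis ℝ E with hb
  have hc : ∀ i, curvature g (FiberBundle.extend E (E := fun q : M => TangentSpace I q) (x := p)
      (b i)) (e 0) (e 0) p
        = frameTwist g e p ^ 2 • (b i - g.inner p (b i) (e 0 p) • e 0 p) := by
    intro i
    obtain ⟨s, hs, hsm⟩ := FiberBundle.exists_contMDiffOn_extend (k := ∞) I E
      (V := fun q : M => TangentSpace I q) (x₀ := p) (b i)
    obtain ⟨V, hVs, hV, hpV⟩ := mem_nhds_iff.mp hs
    rw [h.curvature_eq hE hkill hV (hsm.mono hVs) hp hpV, FiberBundle.extend_apply_self]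
  -- The basis need not be orthonormal; this sum is the trace of v ↦ g(v, ξ) ξ, which is g(ξ, ξ).
  have hξ : ∑ i, b.coord i (e 0 p) * g.inner p (b i) (e 0 p) = 1 := by
    have h1 : g.inner p (e 0 p) (e 0 p) = 1 := by simpa using h.inner_eq p hp 0 0
    rw [← h1]
    conv_rhs => arg 2; rw [← b.sum_repr (e 0 p)]
    rw [map_sum]
    refine Finset.sum_congr rfl fun i _ => ?_
    rw [map_smul, smul_eq_mul, Module.Basis.coord_apply, g.symm]
  have hsum : ricci g (e 0) (e 0) p = frameTwist g e p ^ 2 * 2 := by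
    rw [ricci]
    have : ∀ i, b.coord i (curvature g
        (FiberBundle.extend E (E := fun q : M => TangentSpace I q) (x := p) (b i))
          (e 0) (e 0) p) = frameTwist g e p ^ 2 *
            (1 - b.coord i (e 0 p) * g.inner p (b i) (e 0 p)) := by
      intro i
      rw [hc]
      simp only [map_smul, map_sub, Module.Basis.coord_apply, Module.Basis.repr_self,
        Finsupp.single_eq_same, smul_eq_mul]
      ring
    refine (Finset.sum_congr rfl fun i _ => this i).trans ?_
    rw [← Finset.mul_sum, Finset.sum_sub_distrib, hξ]
    simp [hE]
    norm_num
  rw [ricciFunction, hsum, hE]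
  norm_num

end IsOrthonormalOn

end Curvature

/-! ### Kähler structures from the commutation relations of a hermitian frame -/

section HermitianFrame

variable {E : Type*} [NormedAddCommGroup E] [NormedSpace ℝ E]
  {H : Type*} [TopologicalSpace H] {I : ModelWithCorners ℝ E H}
  {N : Type*} [TopologicalSpace N] [ChartedSpace H N] [IsManifold I ∞ N]

/-- `F` is a smooth frame on the open set `W`, orthonormal for `G`, with `J F₀ = F₃` and
`J F₁ = F₂`. -/
structure IsHermitianFrameOn (G : Π x : N, TangentSpace I x →L[ℝ] TangentSpace I x →L[ℝ] ℝ)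
    (J : Π x : N, TangentSpace I x →L[ℝ] TangentSpace I x)
    (F : Fin 4 → Π x : N, TangentSpace I x) (W : Set N) : Prop where
  isOpen : IsOpen W
  smooth : ∀ i, ContMDiffOn I I.tangent ∞ (T% (F i)) W
  coeff_smooth : ∀ (V : Set N) (X : Π x : N, TangentSpace I x), IsOpen V → V ⊆ W →
    ContMDiffOn I I.tangent ∞ (T% X) V → ∀ i,
      ContMDiffOn I 𝓘(ℝ, ℝ) ∞ (fun x => G x (X x) (F i x)) V
  expand : ∀ x ∈ W, ∀ v : TangentSpace I x, v = ∑ i, G x v (F i x) • F i x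
  inner_eq : ∀ x ∈ W, ∀ i j, G x (F i x) (F j x) = if i = j then 1 else 0
  J_zero : ∀ x ∈ W, J x (F 0 x) = F 3 x
  J_one : ∀ x ∈ W, J x (F 1 x) = F 2 x
  J_two : ∀ x ∈ W, J x (F 2 x) = -F 1 x
  J_three : ∀ x ∈ W, J x (F 3 x) = -F 0 x

namespace IsHermitianFrameOn

variable {G : Π x : N, TangentSpace I x →L[ℝ] TangentSpace I x →L[ℝ] ℝ}
  {J : Π x : N, TangentSpace I x →L[ℝ] TangentSpace I x}
  {F : Fin 4 → Π x : N, TangentSpace I x} {W : Set N}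

theorem J_apply (h : IsHermitianFrameOn G J F W) {x : N} (hx : x ∈ W) (v : TangentSpace I x) :
    J x v = ∑ i, (![-G x v (F 3 x), -G x v (F 2 x), G x v (F 1 x), G x v (F 0 x)] i) • F i x := by
  conv_lhs => rw [h.expand x hx v]
  simp only [Fin.sum_univ_four, map_add, map_smul, h.J_zero x hx, h.J_one x hx, h.J_two x hx,
    h.J_three x hx, Matrix.cons_val]
  module

theorem inner_sum_left (h : IsHermitianFrameOn G J F W) {x : N} (hx : x ∈ W) (a : Fin 4 → ℝ)
    (k : Fin 4) : G x (∑ i, a i • F i x) (F k x) = a k := by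
  simp [map_sum, h.inner_eq x hx]

theorem inner_J (h : IsHermitianFrameOn G J F W) {x : N} (hx : x ∈ W) (v : TangentSpace I x)
    (k : Fin 4) : G x (J x v) (F k x)
      = ![-G x v (F 3 x), -G x v (F 2 x), G x v (F 1 x), G x v (F 0 x)] k := by
  rw [h.J_apply hx, h.inner_sum_left hx]

theorem inner_J_apply (h : IsHermitianFrameOn G J F W) {x : N} (hx : x ∈ W)
    (v w : TangentSpace I x) : G x (J x v) w
      = G x v (F 0 x) * G x w (F 3 x) - G x v (F 3 x) * G x w (F 0 x)
        + G x v (F 1 x) * G x w (F 2 x) - G x v (F 2 x) * G x w (F 1 x) := by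
  conv_lhs => rw [h.expand x hx w]
  simp only [map_add, map_smul, h.inner_J hx, Fin.sum_univ_four, smul_eq_mul, Matrix.cons_val]
  ring

theorem contMDiffOn_J (h : IsHermitianFrameOn G J F W) {V : Set N} {X : Π x : N, TangentSpace I x}
    (hV : IsOpen V) (hVW : V ⊆ W) (hX : ContMDiffOn I I.tangent ∞ (T% X) V) :
    ContMDiffOn I I.tangent ∞ (T% (fun x => J x (X x))) V := by
  have hc := h.coeff_smooth V X hV hVW hX
  have hF := fun i => (h.smooth i).mono hVW
  have h1 : ContMDiffOn I I.tangent ∞ (T% (fun x => ∑ i,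
      ((![-fun x => G x (X x) (F 3 x), -fun x => G x (X x) (F 2 x), fun x => G x (X x) (F 1 x),
        fun x => G x (X x) (F 0 x)] : Fin 4 → N → ℝ) i • F i) x)) V := by
    refine ContMDiffOn.sum_section fun i _ => ContMDiffOn.smul_section ?_ (hF i)
    fin_cases i
    · exact (hc 3).neg
    · exact (hc 2).neg
    · exact hc 1
    · exact hc 0
  refine h1.congr fun x hx => ?_
  rw [h.J_apply (hVW hx)]
  simp [Fin.sum_univ_four]

variable [CompleteSpace E]

theorem inner_mlieBracket (h : IsHermitianFrameOn G J F W) {V : Set N}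
    {X Y : Π x : N, TangentSpace I x} (hV : IsOpen V) (hVW : V ⊆ W)
    (hX : ContMDiffOn I I.tangent ∞ (T% X) V) (hY : ContMDiffOn I I.tangent ∞ (T% Y) V)
    {x : N} (hx : x ∈ V) (k : Fin 4) :
    G x (mlieBracket I X Y x) (F k x)
      = mvfderiv I (fun y => G y (Y y) (F k y)) x (X x)
        - mvfderiv I (fun y => G y (X y) (F k y)) x (Y x)
        + ∑ i, ∑ j, G x (X x) (F i x) * G x (Y x) (F j x)
            * G x (mlieBracket I (F i) (F j) x) (F k x) := by
  have hc : ∀ Z : Π x : N, TangentSpace I x,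
      Z =ᶠ[𝓝 x] fun q => ∑ i, G q (Z q) (F i q) • F i q := by
    intro Z
    filter_upwards [hV.mem_nhds hx] with q hq using h.expand q (hVW hq) (Z q)
  have e := ((hc X).mlieBracket_vectorField_eq (hc Y)).trans (mlieBracket_sum_sum
      (fun i => mdifferentiableAt_of_contMDiffOn hV (h.coeff_smooth V X hV hVW hX i) hx)
      (fun i => mdifferentiableAt_of_contMDiffOn hV (h.coeff_smooth V Y hV hVW hY i) hx)
      (fun i => mdifferentiableAt_of_contMDiffOn h.isOpen (h.smooth i) (hVW hx)))
  rw [← h.expand x (hVW hx) (X x), ← h.expand x (hVW hx) (Y x)] at e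
  rw [e, map_add, add_apply, h.inner_sum_left (hVW hx)]
  simp [map_sum]

/-- The commutation relations of the frame `ξ/t, e₁/t, e₂/t, √c ∂_t` of the cone over a Sasakian
3-manifold, at the point `x`. -/
structure HasConeBrackets (F : Fin 4 → Π x : N, TangentSpace I x) (x : N) (σ β κ μ : ℝ) :
    Prop where
  zero_one : mlieBracket I (F 0) (F 1) x = β • F 2 x
  zero_two : mlieBracket I (F 0) (F 2) x = -(β • F 1 x)
  zero_three : mlieBracket I (F 0) (F 3) x = σ • F 0 x
  one_two : mlieBracket I (F 1) (F 2) x = (2 * σ) • F 0 x + κ • F 1 x + μ • F 2 x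
  one_three : mlieBracket I (F 1) (F 3) x = σ • F 1 x
  two_three : mlieBracket I (F 2) (F 3) x = σ • F 2 x

variable {σ β κ μ : ℝ} {x : N}

/-- The structure constants are collected by component of the bracket. The last entry is 0 because
no bracket of the frame has a component along F₃. -/
theorem inner_mlieBracket_of_hasConeBrackets (h : IsHermitianFrameOn G J F W)
    (hb : HasConeBrackets F x σ β κ μ) {V : Set N}
    {X Y : Π x : N, TangentSpace I x} (hV : IsOpen V) (hVW : V ⊆ W)
    (hX : ContMDiffOn I I.tangent ∞ (T% X) V) (hY : ContMDiffOn I I.tangent ∞ (T% Y) V)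
    (hx : x ∈ V) (k : Fin 4) :
    G x (mlieBracket I X Y x) (F k x)
      = mvfderiv I (fun y => G y (Y y) (F k y)) x (X x)
        - mvfderiv I (fun y => G y (X y) (F k y)) x (Y x)
        + ![σ * (G x (X x) (F 0 x) * G x (Y x) (F 3 x) - G x (X x) (F 3 x) * G x (Y x) (F 0 x))
              + 2 * σ * (G x (X x) (F 1 x) * G x (Y x) (F 2 x)
                - G x (X x) (F 2 x) * G x (Y x) (F 1 x)),
            σ * (G x (X x) (F 1 x) * G x (Y x) (F 3 x) - G x (X x) (F 3 x) * G x (Y x) (F 1 x))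
              - β * (G x (X x) (F 0 x) * G x (Y x) (F 2 x)
                - G x (X x) (F 2 x) * G x (Y x) (F 0 x))
              + κ * (G x (X x) (F 1 x) * G x (Y x) (F 2 x)
                - G x (X x) (F 2 x) * G x (Y x) (F 1 x)),
            σ * (G x (X x) (F 2 x) * G x (Y x) (F 3 x) - G x (X x) (F 3 x) * G x (Y x) (F 2 x))
              + β * (G x (X x) (F 0 x) * G x (Y x) (F 1 x)
                - G x (X x) (F 1 x) * G x (Y x) (F 0 x))
              + μ * (G x (X x) (F 1 x) * G x (Y x) (F 2 x)
                - G x (X x) (F 2 x) * G x (Y x) (F 1 x)),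
            0] k := by
  rw [h.inner_mlieBracket hV hVW hX hY hx k]
  have hin := h.inner_eq x (hVW hx)
  have h10 := mlieBracket_swap_apply (I := I) (V := F 1) (W := F 0) (x := x)
  have h20 := mlieBracket_swap_apply (I := I) (V := F 2) (W := F 0) (x := x)
  have h30 := mlieBracket_swap_apply (I := I) (V := F 3) (W := F 0) (x := x)
  have h21 := mlieBracket_swap_apply (I := I) (V := F 2) (W := F 1) (x := x)
  have h31 := mlieBracket_swap_apply (I := I) (V := F 3) (W := F 1) (x := x)
  have h32 := mlieBracket_swap_apply (I := I) (V := F 3) (W := F 2) (x := x)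
  simp only [Fin.sum_univ_four, mlieBracket_self, h10, h20, h30, h21, h31, h32, hb.zero_one,
    hb.zero_two, hb.zero_three, hb.one_two, hb.one_three, hb.two_three, map_add, map_neg,
    map_smul, add_apply, neg_apply, smul_apply, hin, map_zero, zero_apply]
  congr 1
  fin_cases k <;> simp <;> ring

/-- J has constant entries in the frame, so the derivatives of the coefficients of X and Y cancel.
The structure constants cancel because [F₀, ·] and [F₃, ·] commute with J on the span of F₁, F₂; the
values of κ and μ are irrelevant. The relations are needed only at x, since second derivatives do
not occur. -/
theorem nijenhuis_eq_zero (h : IsHermitianFrameOn G J F W)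
    (hb : HasConeBrackets F x σ β κ μ) {V : Set N}
    {X Y : Π x : N, TangentSpace I x} (hV : IsOpen V) (hVW : V ⊆ W)
    (hX : ContMDiffOn I I.tangent ∞ (T% X) V) (hY : ContMDiffOn I I.tangent ∞ (T% Y) V)
    (hx : x ∈ V) : nijenhuis I J X Y x = 0 := by
  have hJX := h.contMDiffOn_J hV hVW hX
  have hJY := h.contMDiffOn_J hV hVW hY
  -- J permutes the frame up to sign, so it permutes the derivatives of the coefficients in the same
  -- way.
  have hd : ∀ (Z : Π x : N, TangentSpace I x) (k : Fin 4),
      mvfderiv I (fun y => G y (J y (Z y)) (F k y)) x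
        = ![-mvfderiv I (fun y => G y (Z y) (F 3 y)) x, -mvfderiv I (fun y => G y (Z y) (F 2 y)) x,
            mvfderiv I (fun y => G y (Z y) (F 1 y)) x,
            mvfderiv I (fun y => G y (Z y) (F 0 y)) x] k := by
    intro Z k
    have e : (fun y => G y (J y (Z y)) (F k y)) =ᶠ[𝓝 x] fun y =>
        ![-G y (Z y) (F 3 y), -G y (Z y) (F 2 y), G y (Z y) (F 1 y), G y (Z y) (F 0 y)] k := by
      filter_upwards [hV.mem_nhds hx] with y hy using h.inner_J (hVW hy) (Z y) k
    rw [mvfderiv_eventuallyEq e]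
    fin_cases k
    · exact mvfderiv_neg (I := I)
    · exact mvfderiv_neg (I := I)
    · rfl
    · rfl
  have key : ∀ k, G x (nijenhuis I J X Y x) (F k x) = 0 := by
    intro k
    rw [nijenhuis]
    simp only [map_sub, sub_apply, h.inner_J (hVW hx),
      h.inner_mlieBracket_of_hasConeBrackets hb hV hVW hJX hJY hx,
      h.inner_mlieBracket_of_hasConeBrackets hb hV hVW hJX hY hx,
      h.inner_mlieBracket_of_hasConeBrackets hb hV hVW hX hJY hx,
      h.inner_mlieBracket_of_hasConeBrackets hb hV hVW hX hY hx, hd]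
    fin_cases k <;> simp <;> ring
  rw [h.expand x (hVW hx) (nijenhuis I J X Y x)]
  simp [key]

/-- In frame coefficients Ω = F⁰∧F³ + F¹∧F². The derivative terms cancel as for any 2-form; among
the structure constants the decisive balance is 2σ from [F₁, F₂] against σ from each of [F₁, F₃] and
[F₂, F₃]. -/
theorem dFundamentalForm_eq_zero (h : IsHermitianFrameOn G J F W)
    (hb : HasConeBrackets F x σ β κ μ) {V : Set N}
    {X Y Z : Π x : N, TangentSpace I x} (hV : IsOpen V) (hVW : V ⊆ W)
    (hX : ContMDiffOn I I.tangent ∞ (T% X) V) (hY : ContMDiffOn I I.tangent ∞ (T% Y) V)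
    (hZ : ContMDiffOn I I.tangent ∞ (T% Z) V)
    (hx : x ∈ V) : dFundamentalForm I G J X Y Z x = 0 := by
  have hd : ∀ (A B : Π x : N, TangentSpace I x), ContMDiffOn I I.tangent ∞ (T% A) V →
      ContMDiffOn I I.tangent ∞ (T% B) V → ∀ v : TangentSpace I x,
      mvfderiv I (fun y => G y (J y (A y)) (B y)) x v
        = G x (A x) (F 0 x) * mvfderiv I (fun y => G y (B y) (F 3 y)) x v
          + mvfderiv I (fun y => G y (A y) (F 0 y)) x v * G x (B x) (F 3 x)
          - (G x (A x) (F 3 x) * mvfderiv I (fun y => G y (B y) (F 0 y)) x v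
          + mvfderiv I (fun y => G y (A y) (F 3 y)) x v * G x (B x) (F 0 x))
          + (G x (A x) (F 1 x) * mvfderiv I (fun y => G y (B y) (F 2 y)) x v
          + mvfderiv I (fun y => G y (A y) (F 1 y)) x v * G x (B x) (F 2 x))
          - (G x (A x) (F 2 x) * mvfderiv I (fun y => G y (B y) (F 1 y)) x v
          + mvfderiv I (fun y => G y (A y) (F 2 y)) x v * G x (B x) (F 1 x)) := by
    intro A B hA hB v
    set a : Fin 4 → N → ℝ := fun i y => G y (A y) (F i y) with ha
    set b : Fin 4 → N → ℝ := fun i y => G y (B y) (F i y) with hb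
    have had : ∀ i, MDifferentiableAt I 𝓘(ℝ, ℝ) (a i) x := fun i =>
      mdifferentiableAt_of_contMDiffOn hV (h.coeff_smooth V A hV hVW hA i) hx
    have hbd : ∀ i, MDifferentiableAt I 𝓘(ℝ, ℝ) (b i) x := fun i =>
      mdifferentiableAt_of_contMDiffOn hV (h.coeff_smooth V B hV hVW hB i) hx
    have e : (fun y => G y (J y (A y)) (B y)) =ᶠ[𝓝 x]
        a 0 * b 3 - a 3 * b 0 + a 1 * b 2 - a 2 * b 1 := by
      filter_upwards [hV.mem_nhds hx] with y hy using h.inner_J_apply (hVW hy) (A y) (B y)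
    have hm : ∀ i j, MDifferentiableAt I 𝓘(ℝ, ℝ) (a i * b j) x := fun i j => (had i).mul (hbd j)
    rw [mvfderiv_eventuallyEq e, mvfderiv_sub (((hm 0 3).sub (hm 3 0)).add (hm 1 2)) (hm 2 1),
      mvfderiv_add ((hm 0 3).sub (hm 3 0)) (hm 1 2), mvfderiv_sub (hm 0 3) (hm 3 0),
      mvfderiv_mul (had 0) (hbd 3), mvfderiv_mul (had 3) (hbd 0), mvfderiv_mul (had 1) (hbd 2),
      mvfderiv_mul (had 2) (hbd 1)]
    simp [ha, hb]
    ring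
  rw [dFundamentalForm, hd Y Z hY hZ, hd X Z hX hZ, hd X Y hX hY]
  simp only [h.inner_J_apply (hVW hx),
      h.inner_mlieBracket_of_hasConeBrackets hb hV hVW hX hY hx,
      h.inner_mlieBracket_of_hasConeBrackets hb hV hVW hX hZ hx,
      h.inner_mlieBracket_of_hasConeBrackets hb hV hVW hY hZ hx, Matrix.cons_val]
  ring

omit [CompleteSpace E] in
theorem inner_eq_sum (h : IsHermitianFrameOn G J F W) {x : N} (hx : x ∈ W)
    (v w : TangentSpace I x) : G x v w = ∑ i, G x v (F i x) * G x w (F i x) := by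
  conv_lhs => rw [h.expand x hx w]
  rw [map_sum]
  exact Finset.sum_congr rfl fun i _ => by rw [map_smul, smul_eq_mul, mul_comm]

omit [CompleteSpace E] in
theorem inner_self_pos (h : IsHermitianFrameOn G J F W) {x : N} (hx : x ∈ W)
    {v : TangentSpace I x} (hv : v ≠ 0) : 0 < G x v v := by
  rw [h.inner_eq_sum hx]
  refine lt_of_le_of_ne (Finset.sum_nonneg fun i _ => mul_self_nonneg _) fun h0 => hv ?_
  have h1 := (Finset.sum_eq_zero_iff_of_nonneg fun i _ => mul_self_nonneg _).mp h0.symm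
  rw [h.expand x hx v]
  exact Finset.sum_eq_zero fun i hi => by rw [mul_self_eq_zero.mp (h1 i hi), zero_smul]

/-- A structure that admits local hermitian frames with the commutation relations of the cone is
Kähler. -/
theorem isKahlerOn {U : Set N} (hU : IsOpen U)
    (hF : ∀ x ∈ U, ∃ (F : Fin 4 → Π x : N, TangentSpace I x) (W : Set N) (σ β κ μ : ℝ),
      x ∈ W ∧ IsHermitianFrameOn G J F W ∧ HasConeBrackets F x σ β κ μ) :
    IsKahlerOn I G J U where
  isOpen := hU
  metric_symm x hx v w := by
    obtain ⟨F, W, -, -, -, -, hxW, h, -⟩ := hF x hx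
    rw [h.inner_eq_sum hxW v w, h.inner_eq_sum hxW w v]
    exact Finset.sum_congr rfl fun i _ => mul_comm _ _
  metric_pos x hx v hv := by
    obtain ⟨F, W, -, -, -, -, hxW, h, -⟩ := hF x hx
    exact h.inner_self_pos hxW hv
  metric_smooth V X Y hV hVU hX hY x hx := by
    obtain ⟨F, W, -, -, -, -, hxW, h, -⟩ := hF x (hVU hx)
    have hVW := hV.inter h.isOpen
    have hcX := h.coeff_smooth (V ∩ W) X hVW Set.inter_subset_right
      (hX.mono Set.inter_subset_left)
    have hcY := h.coeff_smooth (V ∩ W) Y hVW Set.inter_subset_right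
      (hY.mono Set.inter_subset_left)
    have hs : ContMDiffOn I 𝓘(ℝ, ℝ) ∞
        (fun x => ∑ i, G x (X x) (F i x) * G x (Y x) (F i x)) (V ∩ W) :=
      contMDiffOn_finsetSum fun i _ => (hcX i).mul (hcY i)
    have hs' := hs.congr fun y hy => h.inner_eq_sum hy.2 (X y) (Y y)
    exact (hs'.contMDiffAt (hVW.mem_nhds ⟨hx, hxW⟩)).contMDiffWithinAt
  J_sq x hx v := by
    obtain ⟨F, W, -, -, -, -, hxW, h, -⟩ := hF x hx
    rw [h.J_apply hxW (J x v)]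
    conv_rhs => rw [h.expand x hxW v]
    simp only [h.inner_J hxW, Fin.sum_univ_four, Matrix.cons_val]
    module
  J_smooth V X hV hVU hX x hx := by
    obtain ⟨F, W, -, -, -, -, hxW, h, -⟩ := hF x (hVU hx)
    have hVW := hV.inter h.isOpen
    exact ((h.contMDiffOn_J hVW Set.inter_subset_right (hX.mono Set.inter_subset_left)).contMDiffAt
      (hVW.mem_nhds ⟨hx, hxW⟩)).contMDiffWithinAt
  hermitian x hx v w := by
    obtain ⟨F, W, -, -, -, -, hxW, h, -⟩ := hF x hx
    rw [h.inner_J_apply hxW, h.inner_eq_sum hxW v w]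
    simp only [h.inner_J hxW, Fin.sum_univ_four, Matrix.cons_val]
    ring
  integrable V X Y hV hVU hX hY x hx := by
    obtain ⟨F, W, σ, β, κ, μ, hxW, h, hb⟩ := hF x (hVU hx)
    exact h.nijenhuis_eq_zero hb (hV.inter h.isOpen) Set.inter_subset_right
      (hX.mono Set.inter_subset_left) (hY.mono Set.inter_subset_left) ⟨hx, hxW⟩
  closed V X Y Z hV hVU hX hY hZ x hx := by
    obtain ⟨F, W, σ, β, κ, μ, hxW, h, hb⟩ := hF x (hVU hx)
    exact h.dFundamentalForm_eq_zero hb (hV.inter h.isOpen) Set.inter_subset_right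
      (hX.mono Set.inter_subset_left) (hY.mono Set.inter_subset_left)
      (hZ.mono Set.inter_subset_left) ⟨hx, hxW⟩

end IsHermitianFrameOn

end HermitianFrame

/-! ### Vector fields and Lie brackets on M × ℝ -/

section Cylinder

variable {E : Type*} [NormedAddCommGroup E] [NormedSpace ℝ E]
  {H : Type*} [TopologicalSpace H] {I : ModelWithCorners ℝ E H}
  {M : Type*} [TopologicalSpace M] [ChartedSpace H M]

/-- The vector field on `M × ℝ` that is `X` along `M` and has no component along `ℝ`. -/
def horizontalLift (X : Π p : M, TangentSpace I p) (x : M × ℝ) :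
    TangentSpace (I.prod 𝓘(ℝ, ℝ)) x :=
  ((X x.1, (0 : ℝ)) : E × ℝ)

variable (I M) in
/-- The coordinate vector field `∂_t` on `M × ℝ`. -/
def verticalField (x : M × ℝ) : TangentSpace (I.prod 𝓘(ℝ, ℝ)) x :=
  ((0, 1) : E × ℝ)

theorem mvfderiv_comp_fst {h : M → ℝ} {x : M × ℝ} (hh : MDifferentiableAt I 𝓘(ℝ, ℝ) h x.1)
    (v : TangentSpace (I.prod 𝓘(ℝ, ℝ)) x) :
    mvfderiv (I.prod 𝓘(ℝ, ℝ)) (fun y : M × ℝ => h y.1) x v = mvfderiv I h x.1 (v : E × ℝ).1 := by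
  have h1 := mvfderiv_comp_apply (I' := I.prod 𝓘(ℝ, ℝ)) (f := fun y : M × ℝ => y.1) x hh
    mdifferentiableAt_fst v
  rw [mfderiv_fst] at h1
  exact h1

theorem mvfderiv_comp_snd {h : ℝ → ℝ} {x : M × ℝ} (hh : DifferentiableAt ℝ h x.2)
    (v : TangentSpace (I.prod 𝓘(ℝ, ℝ)) x) :
    mvfderiv (I.prod 𝓘(ℝ, ℝ)) (fun y : M × ℝ => h y.2) x v = deriv h x.2 * (v : E × ℝ).2 := by
  have h1 := mvfderiv_comp_apply (I' := I.prod 𝓘(ℝ, ℝ)) (f := fun y : M × ℝ => y.2) x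
    hh.mdifferentiableAt mdifferentiableAt_snd v
  rw [mfderiv_snd] at h1
  refine h1.trans ?_
  have h2 : mvfderiv 𝓘(ℝ, ℝ) h x.2 (v : E × ℝ).2 = fderiv ℝ h x.2 (v : E × ℝ).2 := by
    rw [← mfderiv_eq_fderiv]
    rfl
  refine h2.trans ?_
  rw [fderiv_eq_smul_deriv, smul_eq_mul, mul_comm]

variable [IsManifold I ∞ M]

theorem contMDiffOn_horizontalLift {X : Π p : M, TangentSpace I p} {U : Set M}
    (hX : ContMDiffOn I I.tangent ∞ (T% X) U) :
    ContMDiffOn (I.prod 𝓘(ℝ, ℝ)) (I.prod 𝓘(ℝ, ℝ)).tangent ∞ (T% (horizontalLift X))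
      (U ×ˢ Set.univ) := by
  have h0 : ContMDiff 𝓘(ℝ, ℝ) 𝓘(ℝ, ℝ).tangent ∞
      (fun t : ℝ => (⟨t, 0⟩ : TangentBundle 𝓘(ℝ, ℝ) ℝ)) :=
    Bundle.contMDiff_zeroSection ℝ (TangentSpace 𝓘(ℝ, ℝ))
  have h1 := hX.comp (contMDiffOn_fst (J := 𝓘(ℝ, ℝ)) (s := U ×ˢ (Set.univ : Set ℝ)))
    fun x hx => hx.1
  have h2 := h0.comp (contMDiff_snd (I := I) (M := M) (J := 𝓘(ℝ, ℝ)))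
  exact contMDiff_equivTangentBundleProd_symm.comp_contMDiffOn (h1.prodMk h2.contMDiffOn)

theorem contMDiff_verticalField :
    ContMDiff (I.prod 𝓘(ℝ, ℝ)) (I.prod 𝓘(ℝ, ℝ)).tangent ∞ (T% (verticalField I M)) := by
  have h0 : ContMDiff I I.tangent ∞ (fun p : M => (⟨p, 0⟩ : TangentBundle I M)) :=
    Bundle.contMDiff_zeroSection ℝ (TangentSpace I)
  have h1 : ContMDiff 𝓘(ℝ, ℝ) 𝓘(ℝ, ℝ).tangent ∞
      (fun t : ℝ => (⟨t, (1 : ℝ)⟩ : TangentBundle 𝓘(ℝ, ℝ) ℝ)) :=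
    contMDiff_vectorSpace_iff_contDiff.mpr contDiff_const
  have h2 := h0.comp (contMDiff_fst (I := I) (M := M) (J := 𝓘(ℝ, ℝ)) (N := ℝ))
  have h3 := h1.comp (contMDiff_snd (I := I) (M := M) (J := 𝓘(ℝ, ℝ)))
  exact contMDiff_equivTangentBundleProd_symm.comp (h2.prodMk h3)

/-- The component along `M` of a smooth vector field on `M × ℝ` is smooth. -/
theorem contMDiffOn_fst_component {X : Π x : M × ℝ, TangentSpace (I.prod 𝓘(ℝ, ℝ)) x}
    {V : Set (M × ℝ)}
    (hX : ContMDiffOn (I.prod 𝓘(ℝ, ℝ)) (I.prod 𝓘(ℝ, ℝ)).tangent ∞ (T% X) V) :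
    ContMDiffOn (I.prod 𝓘(ℝ, ℝ)) I.tangent ∞
      (fun x => (⟨x.1, (X x : E × ℝ).1⟩ : TangentBundle I M)) V :=
  (contMDiff_fst.comp contMDiff_equivTangentBundleProd).comp_contMDiffOn hX

theorem contMDiffOn_snd_component {X : Π x : M × ℝ, TangentSpace (I.prod 𝓘(ℝ, ℝ)) x}
    {V : Set (M × ℝ)}
    (hX : ContMDiffOn (I.prod 𝓘(ℝ, ℝ)) (I.prod 𝓘(ℝ, ℝ)).tangent ∞ (T% X) V) :
    ContMDiffOn (I.prod 𝓘(ℝ, ℝ)) 𝓘(ℝ, ℝ) ∞ (fun x => (X x : E × ℝ).2) V :=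
  (contMDiff_snd_tangentBundle_modelSpace ℝ 𝓘(ℝ, ℝ)).comp_contMDiffOn
    ((contMDiff_snd.comp contMDiff_equivTangentBundleProd).comp_contMDiffOn hX)

/-- Linear functionals composed with a chart already separate tangent vectors, because the
derivative of the chart is injective. These functions are smooth only near p, hence the open set U
in the hypothesis. -/
theorem eq_of_forall_mvfderiv {p : M} {v w : TangentSpace I p}
    (h : ∀ (f : M → ℝ) (U : Set M), IsOpen U → p ∈ U → ContMDiffOn I 𝓘(ℝ, ℝ) ∞ f U →
      mvfderiv I f p v = mvfderiv I f p w) : v = w := by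
  have hinv := isInvertible_mfderiv_extChartAt (I := I) (mem_extChartAt_source (I := I) p)
  refine hinv.injective ?_
  refine (SeparatingDual.eq_iff_forall_dual_eq (R := ℝ) (V := E)).mpr fun l => ?_
  have hs : ContMDiffOn I 𝓘(ℝ, ℝ) ∞ (fun q => l (extChartAt I p q)) (chartAt H p).source :=
    l.contMDiff.comp_contMDiffOn contMDiffOn_extChartAt
  have h1 := h _ _ (chartAt H p).open_source (mem_chart_source H p) hs
  have h2 : ∀ u : TangentSpace I p, mvfderiv I (fun q => l (extChartAt I p q)) p u
      = l (mfderiv I 𝓘(ℝ, E) (extChartAt I p) p u) := by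
    intro u
    have h3 := mvfderiv_comp_apply (I := 𝓘(ℝ, E)) (g := l) p
      l.differentiableAt.mdifferentiableAt
      (mdifferentiableAt_extChartAt (I := I) (mem_chart_source H p)) u
    refine h3.trans ?_
    have h4 : mfderiv 𝓘(ℝ, E) 𝓘(ℝ, ℝ) l (extChartAt I p p) = l := by
      rw [mfderiv_eq_fderiv]
      exact l.fderiv
    exact congrArg (fun m : E →L[ℝ] ℝ => m (mfderiv I 𝓘(ℝ, E) (extChartAt I p) p u)) h4
  rwa [h2, h2] at h1

variable [CompleteSpace E]

/-- The projection to M relates X' to X and Y' to Y, and brackets of related fields are related.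
This is tested on functions pulled back from M, on which a bracket acts as a commutator. -/
theorem fst_mlieBracket {X' Y' : Π x : M × ℝ, TangentSpace (I.prod 𝓘(ℝ, ℝ)) x}
    {X Y : Π p : M, TangentSpace I p} {W : Set (M × ℝ)} {U : Set M} (hW : IsOpen W) (hU : IsOpen U)
    (hX' : ContMDiffOn (I.prod 𝓘(ℝ, ℝ)) (I.prod 𝓘(ℝ, ℝ)).tangent ∞ (T% X') W)
    (hY' : ContMDiffOn (I.prod 𝓘(ℝ, ℝ)) (I.prod 𝓘(ℝ, ℝ)).tangent ∞ (T% Y') W)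
    (hX : ContMDiffOn I I.tangent ∞ (T% X) U) (hY : ContMDiffOn I I.tangent ∞ (T% Y) U)
    (hXX' : ∀ x ∈ W, (X' x : E × ℝ).1 = X x.1) (hYY' : ∀ x ∈ W, (Y' x : E × ℝ).1 = Y x.1)
    {x : M × ℝ} (hx : x ∈ W) (hxU : x.1 ∈ U) :
    (mlieBracket (I.prod 𝓘(ℝ, ℝ)) X' Y' x : E × ℝ).1 = mlieBracket I X Y x.1 := by
  refine eq_of_forall_mvfderiv (I := I) fun f U₀ hU₀ hxU₀ hf => ?_
  have hU' : IsOpen (U ∩ U₀) := hU.inter hU₀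
  have hf' := hf.mono (Set.inter_subset_right (s := U))
  have hX1 := hX.mono (Set.inter_subset_left (t := U₀))
  have hY1 := hY.mono (Set.inter_subset_left (t := U₀))
  have hW' : IsOpen (W ∩ Prod.fst ⁻¹' (U ∩ U₀)) := hW.inter (hU'.preimage continuous_fst)
  have hxW' : x ∈ W ∩ Prod.fst ⁻¹' (U ∩ U₀) := ⟨hx, hxU, hxU₀⟩
  have hff : ContMDiffOn (I.prod 𝓘(ℝ, ℝ)) 𝓘(ℝ, ℝ) ∞ (fun y : M × ℝ => f y.1)
      (W ∩ Prod.fst ⁻¹' (U ∩ U₀)) :=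
    hf'.comp contMDiffOn_fst fun y hy => hy.2
  have hfd : ∀ {q}, q ∈ U ∩ U₀ → MDifferentiableAt I 𝓘(ℝ, ℝ) f q :=
    fun hq => mdifferentiableAt_of_contMDiffOn hU' hf' hq
  have hder : ∀ {Z' : Π x : M × ℝ, TangentSpace (I.prod 𝓘(ℝ, ℝ)) x}
      {Z : Π p : M, TangentSpace I p}, ContMDiffOn I I.tangent ∞ (T% Z) (U ∩ U₀) →
      (∀ x ∈ W, (Z' x : E × ℝ).1 = Z x.1) → ∀ v : TangentSpace (I.prod 𝓘(ℝ, ℝ)) x,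
      mvfderiv (I.prod 𝓘(ℝ, ℝ))
        (fun y => mvfderiv (I.prod 𝓘(ℝ, ℝ)) (fun y : M × ℝ => f y.1) y (Z' y)) x v
        = mvfderiv I (fun q => mvfderiv I f q (Z q)) x.1 (v : E × ℝ).1 := by
    intro Z' Z hZ hZZ' v
    have e : (fun y => mvfderiv (I.prod 𝓘(ℝ, ℝ)) (fun y : M × ℝ => f y.1) y (Z' y))
        =ᶠ[𝓝 x] fun y => mvfderiv I f y.1 (Z y.1) := by
      filter_upwards [hW'.mem_nhds hxW'] with y hy
      rw [mvfderiv_comp_fst (hfd hy.2), hZZ' y hy.1]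
    rw [mvfderiv_eventuallyEq e]
    exact mvfderiv_comp_fst (mdifferentiableAt_of_contMDiffOn hU'
      (contMDiffOn_mvfderiv_apply hU' hf' hZ) hxW'.2) v
  rw [← mvfderiv_comp_fst (hfd hxW'.2), mvfderiv_mlieBracket hW' hff
    (hX'.mono Set.inter_subset_left) (hY'.mono Set.inter_subset_left) hxW',
    hder hX1 hXX', hder hY1 hYY', hXX' x hx, hYY' x hx,
    mvfderiv_mlieBracket hU' hf' hX1 hY1 hxW'.2]

/-- The ℝ-component of a field is its action on the coordinate t, so this is the commutator formula
for the function t. -/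
theorem snd_mlieBracket {X Y : Π x : M × ℝ, TangentSpace (I.prod 𝓘(ℝ, ℝ)) x} {W : Set (M × ℝ)}
    (hW : IsOpen W)
    (hX : ContMDiffOn (I.prod 𝓘(ℝ, ℝ)) (I.prod 𝓘(ℝ, ℝ)).tangent ∞ (T% X) W)
    (hY : ContMDiffOn (I.prod 𝓘(ℝ, ℝ)) (I.prod 𝓘(ℝ, ℝ)).tangent ∞ (T% Y) W)
    {x : M × ℝ} (hx : x ∈ W) :
    (mlieBracket (I.prod 𝓘(ℝ, ℝ)) X Y x : E × ℝ).2
      = mvfderiv (I.prod 𝓘(ℝ, ℝ)) (fun y => (Y y : E × ℝ).2) x (X x)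
        - mvfderiv (I.prod 𝓘(ℝ, ℝ)) (fun y => (X y : E × ℝ).2) x (Y x) := by
  have hs : ∀ (y : M × ℝ) (v : TangentSpace (I.prod 𝓘(ℝ, ℝ)) y),
      mvfderiv (I.prod 𝓘(ℝ, ℝ)) (fun y : M × ℝ => y.2) y v = (v : E × ℝ).2 := by
    intro y v
    have h := mvfderiv_comp_snd (I := I) (x := y) (h := fun t => t) differentiableAt_id v
    rwa [deriv_id'', one_mul] at h
  have h := mvfderiv_mlieBracket hW (h := fun y : M × ℝ => y.2) contMDiffOn_snd hX hY hx
  simpa only [hs] using h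

theorem mlieBracket_horizontalLift {X Y : Π p : M, TangentSpace I p} {U : Set M} (hU : IsOpen U)
    (hX : ContMDiffOn I I.tangent ∞ (T% X) U) (hY : ContMDiffOn I I.tangent ∞ (T% Y) U)
    {x : M × ℝ} (hx : x.1 ∈ U) :
    mlieBracket (I.prod 𝓘(ℝ, ℝ)) (horizontalLift X) (horizontalLift Y) x
      = horizontalLift (mlieBracket I X Y) x := by
  have hW : IsOpen (U ×ˢ (Set.univ : Set ℝ)) := hU.prod isOpen_univ
  have hX' := contMDiffOn_horizontalLift hX
  have hY' := contMDiffOn_horizontalLift hY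
  have hxW : x ∈ U ×ˢ (Set.univ : Set ℝ) := ⟨hx, trivial⟩
  refine Prod.ext (fst_mlieBracket hW hU hX' hY' hX hY (fun _ _ => rfl) (fun _ _ => rfl) hxW hx) ?_
  refine (snd_mlieBracket hW hX' hY' hxW).trans ?_
  simp only [horizontalLift, mvfderiv_const]
  exact sub_self (0 : ℝ)

theorem mlieBracket_horizontalLift_verticalField {X : Π p : M, TangentSpace I p} {U : Set M}
    (hU : IsOpen U) (hX : ContMDiffOn I I.tangent ∞ (T% X) U) {x : M × ℝ} (hx : x.1 ∈ U) :
    mlieBracket (I.prod 𝓘(ℝ, ℝ)) (horizontalLift X) (verticalField I M) x = 0 := by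
  have hW : IsOpen (U ×ˢ (Set.univ : Set ℝ)) := hU.prod isOpen_univ
  have hX' := contMDiffOn_horizontalLift hX
  have hY' := (contMDiff_verticalField (I := I) (M := M)).contMDiffOn (s := U ×ˢ Set.univ)
  have hxW : x ∈ U ×ˢ (Set.univ : Set ℝ) := ⟨hx, trivial⟩
  -- ∂_t projects to the zero field of M, which plays the role of Y in `fst_mlieBracket`.
  have h0 : ContMDiffOn I I.tangent ∞ (T% (0 : Π p : M, TangentSpace I p)) U :=
    (Bundle.contMDiff_zeroSection ℝ (TangentSpace I)).contMDiffOn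
  refine Prod.ext ((fst_mlieBracket hW hU hX' hY' hX h0 (fun _ _ => rfl) (fun _ _ => rfl)
    hxW hx).trans (congrFun (mlieBracket_zero_right (I := I) (W := X)) x.1)) ?_
  refine (snd_mlieBracket hW hX' hY' hxW).trans ?_
  simp only [horizontalLift, verticalField, mvfderiv_const]
  exact sub_self (0 : ℝ)

end Cylinder

/-! ### The cone metric, its adapted frame and the brackets of that frame -/

noncomputable section Cone

variable {E : Type*} [NormedAddCommGroup E] [NormedSpace ℝ E]
  {H : Type*} [TopologicalSpace H] {I : ModelWithCorners ℝ E H}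
  {M : Type*} [TopologicalSpace M] [ChartedSpace H M] [IsManifold I ∞ M]
  {g : Bundle.ContMDiffRiemannianMetric I ∞ E (fun p : M => TangentSpace I p)}

/-- The tangent vector of `M × ℝ` with components `u` and `τ`. -/
def cylinderVector (x : M × ℝ) (u : TangentSpace I x.1) (τ : ℝ) :
    TangentSpace (I.prod 𝓘(ℝ, ℝ)) x :=
  ((u, τ) : E × ℝ)

omit [IsManifold I ∞ M] in
theorem exists_cylinderVector {x : M × ℝ} (v : TangentSpace (I.prod 𝓘(ℝ, ℝ)) x) :
    ∃ (u : TangentSpace I x.1) (τ : ℝ), v = cylinderVector x u τ :=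
  ⟨(v : E × ℝ).1, (v : E × ℝ).2, rfl⟩

omit [IsManifold I ∞ M] in
theorem cylinderVector_add (x : M × ℝ) (u w : TangentSpace I x.1) (τ ρ : ℝ) :
    cylinderVector x u τ + cylinderVector x w ρ = cylinderVector x (u + w) (τ + ρ) :=
  rfl

omit [IsManifold I ∞ M] in
theorem neg_cylinderVector (x : M × ℝ) (u : TangentSpace I x.1) (τ : ℝ) :
    -cylinderVector x u τ = cylinderVector x (-u) (-τ) :=
  rfl

omit [IsManifold I ∞ M] in
theorem smul_cylinderVector (a : ℝ) (x : M × ℝ) (u : TangentSpace I x.1) (τ : ℝ) :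
    a • cylinderVector x u τ = cylinderVector x (a • u) (a * τ) :=
  rfl

theorem coneMetric_cylinderVector (c : ℝ) (x : M × ℝ) (u w : TangentSpace I x.1) (τ ρ : ℝ) :
    coneMetric g c x (cylinderVector x u τ) (cylinderVector x w ρ)
      = x.2 ^ 2 * g.inner x.1 u w + 1 / c * (τ * ρ) :=
  rfl

theorem coneJ_cylinderVector (ξ : Π p : M, TangentSpace I p) (c : ℝ)
    (j : Π p : M, TangentSpace I p →L[ℝ] TangentSpace I p) (x : M × ℝ) (u : TangentSpace I x.1)
    (τ : ℝ) : coneJ g ξ c j x (cylinderVector x u τ)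
      = cylinderVector x (j x.1 u - (1 / (x.2 * √c)) • τ • ξ x.1)
        ((x.2 * √c) * g.inner x.1 (ξ x.1) u) :=
  rfl

theorem contMDiffOn_coneMetric (c : ℝ) {X Y : Π x : M × ℝ, TangentSpace (I.prod 𝓘(ℝ, ℝ)) x}
    {V : Set (M × ℝ)}
    (hX : ContMDiffOn (I.prod 𝓘(ℝ, ℝ)) (I.prod 𝓘(ℝ, ℝ)).tangent ∞ (T% X) V)
    (hY : ContMDiffOn (I.prod 𝓘(ℝ, ℝ)) (I.prod 𝓘(ℝ, ℝ)).tangent ∞ (T% Y) V) :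
    ContMDiffOn (I.prod 𝓘(ℝ, ℝ)) 𝓘(ℝ, ℝ) ∞ (fun x => coneMetric g c x (X x) (Y x)) V := by
  have ht : ContMDiffOn (I.prod 𝓘(ℝ, ℝ)) 𝓘(ℝ, ℝ) ∞ (fun x : M × ℝ => x.2) V := contMDiffOn_snd
  have h1 := contMDiffOn_inner g (contMDiffOn_fst_component hX) (contMDiffOn_fst_component hY)
  have h2 := (contMDiffOn_snd_component hX).mul (contMDiffOn_snd_component hY)
  have h3 : ContMDiffOn (I.prod 𝓘(ℝ, ℝ)) 𝓘(ℝ, ℝ) ∞ (fun _ : M × ℝ => 1 / c) V := contMDiffOn_const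
  exact ((ht.pow 2).mul h1).add (h3.mul h2)

/-- The frame `e₀/t, e₁/t, e₂/t, √c ∂_t` of the cone. -/
def coneFrame (e : Fin 3 → Π p : M, TangentSpace I p) (c : ℝ) :
    Fin 4 → Π x : M × ℝ, TangentSpace (I.prod 𝓘(ℝ, ℝ)) x :=
  ![(fun x : M × ℝ => x.2⁻¹) • horizontalLift (e 0), (fun x : M × ℝ => x.2⁻¹) • horizontalLift (e 1),
    (fun x : M × ℝ => x.2⁻¹) • horizontalLift (e 2), √c • verticalField I M]

omit [IsManifold I ∞ M] in
theorem coneFrame_castSucc (e : Fin 3 → Π p : M, TangentSpace I p) (c : ℝ) (i : Fin 3)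
    (x : M × ℝ) : coneFrame e c i.castSucc x = cylinderVector x (x.2⁻¹ • e i x.1) 0 := by
  have h : coneFrame e c i.castSucc x = x.2⁻¹ • horizontalLift (e i) x := by
    fin_cases i <;> rfl
  rw [h]
  refine Prod.ext rfl ?_
  exact mul_zero _

omit [IsManifold I ∞ M] in
theorem coneFrame_three (e : Fin 3 → Π p : M, TangentSpace I p) (c : ℝ)
    (x : M × ℝ) : coneFrame e c 3 x = cylinderVector x 0 (√c) := by
  have h : coneFrame e c 3 x = √c • verticalField I M x := rfl
  rw [h]
  refine Prod.ext (smul_zero _) ?_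
  exact mul_one _

variable [FiniteDimensional ℝ E] {e : Fin 3 → Π p : M, TangentSpace I p} {U : Set M} {c : ℝ}

omit [IsManifold I ∞ M] [FiniteDimensional ℝ E] in
theorem contMDiffOn_inv_snd : ContMDiffOn (I.prod 𝓘(ℝ, ℝ)) 𝓘(ℝ, ℝ) ∞ (fun x : M × ℝ => x.2⁻¹)
    (U ×ˢ Set.Ioi 0) := by
  intro x hx
  have hx2 : x.2 ≠ 0 := ne_of_gt hx.2
  exact ContMDiffAt.comp_contMDiffWithinAt x (g := fun t : ℝ => t⁻¹)
    (contDiffAt_inv ℝ hx2).contMDiffAt contMDiffWithinAt_snd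

theorem isHermitianFrameOn_coneFrame (h : IsOrthonormalOn g e U) (hE : Module.finrank ℝ E = 3)
    (hc : 0 < c) {j : Π p : M, TangentSpace I p →L[ℝ] TangentSpace I p}
    (hj0 : ∀ p ∈ U, j p (e 0 p) = 0) (hj1 : ∀ p ∈ U, j p (e 1 p) = e 2 p)
    (hj2 : ∀ p ∈ U, j p (e 2 p) = -e 1 p) :
    IsHermitianFrameOn (coneMetric g c) (coneJ g (e 0) c j) (coneFrame e c)
      (U ×ˢ Set.Ioi 0) := by
  have hsc : √c ≠ 0 := Real.sqrt_ne_zero'.mpr hc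
  have hsq : √c * √c = c := Real.mul_self_sqrt hc.le
  have hsmooth : ∀ i, ContMDiffOn (I.prod 𝓘(ℝ, ℝ)) (I.prod 𝓘(ℝ, ℝ)).tangent ∞
      (T% (coneFrame e c i)) (U ×ˢ Set.Ioi 0) := by
    have hl : ∀ i, ContMDiffOn (I.prod 𝓘(ℝ, ℝ)) (I.prod 𝓘(ℝ, ℝ)).tangent ∞
        (T% ((fun x : M × ℝ => x.2⁻¹) • horizontalLift (e i))) (U ×ˢ Set.Ioi 0) := fun i =>
      contMDiffOn_inv_snd.smul_section ((contMDiffOn_horizontalLift (h.smooth i)).mono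
        (Set.prod_mono_right (Set.subset_univ _)))
    intro i
    fin_cases i
    · exact hl 0
    · exact hl 1
    · exact hl 2
    · exact (contMDiff_verticalField (I := I) (M := M)).contMDiffOn.const_smul_section
  have h3 : ∀ i : Fin 3, i.castSucc ≠ 3 := fun i => (Fin.castSucc_lt_last i).ne
  have hF0 : ∀ x : M × ℝ, coneFrame e c 0 x = cylinderVector x (x.2⁻¹ • e 0 x.1) 0 :=
    coneFrame_castSucc e c 0
  have hF1 : ∀ x : M × ℝ, coneFrame e c 1 x = cylinderVector x (x.2⁻¹ • e 1 x.1) 0 :=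
    coneFrame_castSucc e c 1
  have hF2 : ∀ x : M × ℝ, coneFrame e c 2 x = cylinderVector x (x.2⁻¹ • e 2 x.1) 0 :=
    coneFrame_castSucc e c 2
  refine ⟨h.isOpen.prod isOpen_Ioi, hsmooth, fun V X hV hVW hX i =>
    contMDiffOn_coneMetric c hX ((hsmooth i).mono hVW), ?_, ?_, ?_, ?_, ?_, ?_⟩
  · rintro x ⟨hxU, hx2⟩ v
    have ht : x.2 ≠ 0 := ne_of_gt hx2
    obtain ⟨u, τ, rfl⟩ := exists_cylinderVector v
    rw [Fin.sum_univ_castSucc, show Fin.last 3 = 3 from rfl]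
    simp only [coneFrame_castSucc, coneFrame_three, coneMetric_cylinderVector, map_zero, mul_zero,
      zero_add, add_zero, map_smul, smul_cylinderVector, smul_eq_mul, Fin.sum_univ_three,
      cylinderVector_add]
    conv_lhs => rw [h.expand hE hxU u, Fin.sum_univ_three]
    congr 1
    · match_scalars <;> field_simp
    · field_simp
      rw [pow_two, hsq]
  · rintro x ⟨hxU, hx2⟩ i k
    have ht : x.2 ≠ 0 := ne_of_gt hx2
    induction i using Fin.lastCases with
    | last =>
      induction k using Fin.lastCases with
      | last =>
        rw [show Fin.last 3 = 3 from rfl, coneFrame_three, coneMetric_cylinderVector, map_zero,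
          mul_zero, zero_add, hsq, if_pos rfl, one_div_mul_cancel hc.ne']
      | cast k =>
        rw [show Fin.last 3 = 3 from rfl, coneFrame_three, coneFrame_castSucc, if_neg (h3 k).symm,
          coneMetric_cylinderVector]
        simp only [map_zero, zero_apply, mul_zero, add_zero]
    | cast i =>
      induction k using Fin.lastCases with
      | last =>
        rw [show Fin.last 3 = 3 from rfl, coneFrame_three, coneFrame_castSucc, if_neg (h3 i),
          coneMetric_cylinderVector]
        simp only [map_zero, mul_zero, zero_mul, add_zero]
      | cast k =>
        rw [coneFrame_castSucc, coneFrame_castSucc, coneMetric_cylinderVector]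
        simp only [map_smul, smul_apply, h.inner_eq x.1 hxU, Fin.castSucc_inj, smul_eq_mul,
          mul_zero, add_zero]
        field_simp
  · rintro x ⟨hxU, hx2⟩
    have ht : x.2 ≠ 0 := ne_of_gt hx2
    rw [hF0, coneFrame_three, coneJ_cylinderVector, map_smul, hj0 _ hxU, map_smul,
      h.inner_eq x.1 hxU, if_pos rfl]
    congr 1
    · simp
    · simp
      field_simp
  · rintro x ⟨hxU, hx2⟩
    rw [hF1, hF2, coneJ_cylinderVector, map_smul, hj1 _ hxU, map_smul, h.inner_eq x.1 hxU]
    congr 1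
    · simp
    · simp
  · rintro x ⟨hxU, hx2⟩
    rw [hF1, hF2, coneJ_cylinderVector, map_smul, hj2 _ hxU, map_smul, h.inner_eq x.1 hxU,
      neg_cylinderVector]
    congr 1
    · simp
    · simp
  · rintro x ⟨hxU, hx2⟩
    have ht : x.2 ≠ 0 := ne_of_gt hx2
    rw [hF0, coneFrame_three, coneJ_cylinderVector, neg_cylinderVector, map_zero, map_zero]
    congr 1
    · match_scalars
      field_simp
    · simp

/-- The factor 1/t is constant in horizontal directions, so no derivative term appears. -/
theorem mlieBracket_smul_horizontalLift (h : IsOrthonormalOn g e U) {x : M × ℝ} (hx : x.1 ∈ U)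
    (hx2 : 0 < x.2) (i k : Fin 3) :
    mlieBracket (I.prod 𝓘(ℝ, ℝ)) ((fun x : M × ℝ => x.2⁻¹) • horizontalLift (e i))
        ((fun x : M × ℝ => x.2⁻¹) • horizontalLift (e k)) x
      = cylinderVector x ((x.2⁻¹ * x.2⁻¹) • mlieBracket I (e i) (e k) x.1) 0 := by
  have : CompleteSpace E := FiniteDimensional.complete ℝ E
  have hW : IsOpen (U ×ˢ (Set.univ : Set ℝ)) := h.isOpen.prod isOpen_univ
  have hd : ∀ i, MDifferentiableAt (I.prod 𝓘(ℝ, ℝ)) (I.prod 𝓘(ℝ, ℝ)).tangent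
      (T% (horizontalLift (e i))) x := fun i =>
    mdifferentiableAt_of_contMDiffOn hW (contMDiffOn_horizontalLift (h.smooth i)) ⟨hx, trivial⟩
  have ht : MDifferentiableAt (I.prod 𝓘(ℝ, ℝ)) 𝓘(ℝ, ℝ) (fun x : M × ℝ => x.2⁻¹) x :=
    mdifferentiableAt_of_contMDiffOn (hW.inter (isOpen_Ioi.preimage continuous_snd))
      ((contMDiffOn_inv_snd (I := I) (U := U)).mono fun y hy => ⟨hy.1.1, hy.2⟩)
      ⟨⟨hx, trivial⟩, hx2⟩
  have h0 : ∀ i, mvfderiv (I.prod 𝓘(ℝ, ℝ)) (fun x : M × ℝ => x.2⁻¹) x (horizontalLift (e i) x)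
      = 0 := by
    intro i
    rw [mvfderiv_comp_snd (h := fun t : ℝ => t⁻¹) (differentiableAt_inv hx2.ne')]
    exact mul_zero _
  rw [mlieBracket_smul_left ht (hd i), mlieBracket_smul_right ht (hd k), Pi.smul_apply', map_smul,
    h0, h0, mlieBracket_horizontalLift h.isOpen (h.smooth i) (h.smooth k) hx, smul_zero, neg_zero,
    zero_smul, zero_smul, zero_add, zero_add, smul_smul]
  exact smul_cylinderVector _ x _ 0 |>.trans (by rw [mul_zero])

/-- The lift commutes with ∂_t; the whole bracket comes from ∂_t(1/t) = -1/t². This is the source of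
σ = √c/t. -/
theorem mlieBracket_smul_horizontalLift_verticalField (h : IsOrthonormalOn g e U) {x : M × ℝ}
    (hx : x.1 ∈ U) (hx2 : 0 < x.2) (c : ℝ) (i : Fin 3) :
    mlieBracket (I.prod 𝓘(ℝ, ℝ)) ((fun x : M × ℝ => x.2⁻¹) • horizontalLift (e i))
        (√c • verticalField I M) x
      = (√c * x.2⁻¹) • (x.2⁻¹ • horizontalLift (e i) x) := by
  have : CompleteSpace E := FiniteDimensional.complete ℝ E
  have hW : IsOpen (U ×ˢ (Set.univ : Set ℝ)) := h.isOpen.prod isOpen_univ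
  have hd := mdifferentiableAt_of_contMDiffOn hW (contMDiffOn_horizontalLift (h.smooth i))
    ⟨hx, trivial⟩
  have ht : MDifferentiableAt (I.prod 𝓘(ℝ, ℝ)) 𝓘(ℝ, ℝ) (fun x : M × ℝ => x.2⁻¹) x :=
    mdifferentiableAt_of_contMDiffOn (hW.inter (isOpen_Ioi.preimage continuous_snd))
      ((contMDiffOn_inv_snd (I := I) (U := U)).mono fun y hy => ⟨hy.1.1, hy.2⟩)
      ⟨⟨hx, trivial⟩, hx2⟩
  have hv := (contMDiff_verticalField (I := I) (M := M)).mdifferentiableAt (x := x) (by simp)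
  have h1 : mvfderiv (I.prod 𝓘(ℝ, ℝ)) (fun x : M × ℝ => x.2⁻¹) x (verticalField I M x)
      = -(x.2⁻¹ * x.2⁻¹) := by
    rw [mvfderiv_comp_snd (h := fun t : ℝ => t⁻¹) (differentiableAt_inv hx2.ne'), deriv_inv]
    refine (mul_one _).trans ?_
    rw [pow_two, mul_inv]
  rw [mlieBracket_const_smul_right hv, mlieBracket_smul_left ht hd,
    mlieBracket_horizontalLift_verticalField h.isOpen (h.smooth i) hx, h1, smul_zero, add_zero,
    neg_neg, smul_smul, smul_smul, mul_assoc]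

/-- Twist -√c means that [e₁, e₂] has ξ-component 2√c, and 2√c ξ/t² = 2σ F₀. The sign matters: twist
√c would give -2σ, and Ω would not be closed for this J. -/
theorem hasConeBrackets_coneFrame (h : IsOrthonormalOn g e U) (hE : Module.finrank ℝ E = 3)
    (hkill : IsKilling g (e 0)) (htw : ∀ p ∈ U, frameTwist g e p = -√c) {x : M × ℝ}
    (hx : x.1 ∈ U) (hx2 : 0 < x.2) :
    ∃ σ β κ μ : ℝ, IsHermitianFrameOn.HasConeBrackets (coneFrame e c) x σ β κ μ := by
  have ht : x.2 ≠ 0 := hx2.ne'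
  have hF0 : coneFrame e c 0 x = cylinderVector x (x.2⁻¹ • e 0 x.1) 0 := coneFrame_castSucc e c 0 x
  have hF1 : coneFrame e c 1 x = cylinderVector x (x.2⁻¹ • e 1 x.1) 0 := coneFrame_castSucc e c 1 x
  have hF2 : coneFrame e c 2 x = cylinderVector x (x.2⁻¹ • e 2 x.1) 0 := coneFrame_castSucc e c 2 x
  have hb := mlieBracket_smul_horizontalLift h hx hx2
  have hv := mlieBracket_smul_horizontalLift_verticalField h hx hx2 c
  refine ⟨√c * x.2⁻¹, frameSpin g e x.1 * x.2⁻¹,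
    g.inner x.1 (mlieBracket I (e 1) (e 2) x.1) (e 1 x.1) * x.2⁻¹,
    g.inner x.1 (mlieBracket I (e 1) (e 2) x.1) (e 2 x.1) * x.2⁻¹, ?_, ?_, hv 0, ?_, hv 1, hv 2⟩
  · refine (hb 0 1).trans ?_
    rw [h.bracket_zero_one hE hkill hx, hF2, smul_cylinderVector, mul_zero]
    congr 1
    module
  · refine (hb 0 2).trans ?_
    rw [h.bracket_zero_two hE hkill hx, hF1, smul_cylinderVector, neg_cylinderVector, mul_zero,
      neg_zero]
    congr 1
    module
  · refine (hb 1 2).trans ?_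
    have h0 : g.inner x.1 (mlieBracket I (e 1) (e 2) x.1) (e 0 x.1) = 2 * √c := by
      have := htw x.1 hx
      rw [frameTwist] at this
      linarith
    rw [hF0, hF1, hF2]
    simp only [smul_cylinderVector, cylinderVector_add, mul_zero, add_zero]
    conv_lhs => rw [h.expand hE hx (mlieBracket I (e 1) (e 2) x.1), Fin.sum_univ_three, h0]
    congr 1
    module

/-- The cone over an open set of a 3-manifold is Kähler if the unit Killing field `ξ` has constant
twist there. -/
theorem isKahlerOn_cone (hE : Module.finrank ℝ E = 3) {ξ : Π p : M, TangentSpace I p}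
    (hkill : IsKilling g ξ) (hc : 0 < c) {O : Set M} (hO : IsOpen O)
    {j : Π p : M, TangentSpace I p →L[ℝ] TangentSpace I p}
    (hF : ∀ p ∈ O, ∃ (e : Fin 3 → Π p : M, TangentSpace I p) (U : Set M), p ∈ U ∧
      IsOrthonormalOn g e U ∧ e 0 = ξ ∧ (∀ q ∈ U, frameTwist g e q = -√c) ∧
        ∀ q ∈ U, j q = frameRot g e q) :
    IsKahlerOn (I.prod 𝓘(ℝ, ℝ)) (coneMetric g c) (coneJ g ξ c j) (O ×ˢ Set.Ioi (0 : ℝ)) := by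
  have : CompleteSpace E := FiniteDimensional.complete ℝ E
  refine IsHermitianFrameOn.isKahlerOn (hO.prod isOpen_Ioi) ?_
  rintro x ⟨hxO, hx2⟩
  obtain ⟨e, U, hxU, h, rfl, htw, hj⟩ := hF x.1 hxO
  obtain ⟨σ, β, κ, μ, hb⟩ := hasConeBrackets_coneFrame h hE hkill htw hxU hx2
  exact ⟨coneFrame e c, U ×ˢ Set.Ioi 0, σ, β, κ, μ, ⟨hxU, hx2⟩,
    isHermitianFrameOn_coneFrame h hE hc (fun p hp => by rw [hj p hp, h.frameRot_zero hp])
      (fun p hp => by rw [hj p hp, h.frameRot_one hp])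
      (fun p hp => by rw [hj p hp, h.frameRot_two hp]), hb⟩

end Cone

/-! ### The global rotation of ξ^⊥ and the choice of frames with negative twist -/

noncomputable section Transverse

variable {E : Type*} [NormedAddCommGroup E] [NormedSpace ℝ E] [FiniteDimensional ℝ E]
  {H : Type*} [TopologicalSpace H] {I : ModelWithCorners ℝ E H}
  {M : Type*} [TopologicalSpace M] [ChartedSpace H M] [IsManifold I ∞ M]
  {g : Bundle.ContMDiffRiemannianMetric I ∞ E (fun p : M => TangentSpace I p)}
  {ξ : Π p : M, TangentSpace I p}

namespace IsOrthonormalOn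

variable {e : Fin 3 → Π p : M, TangentSpace I p} {U : Set M}

omit [FiniteDimensional ℝ E] in
theorem swap (h : IsOrthonormalOn g e U) : IsOrthonormalOn g ![e 0, e 2, e 1] U := by
  have hsw : ![e 0, e 2, e 1] = fun i => e (Equiv.swap 1 2 i) := by
    funext i
    fin_cases i <;> rfl
  rw [hsw]
  exact ⟨h.isOpen, fun i => h.smooth _, fun p hp i k => by
    simp only [h.inner_eq p hp, (Equiv.swap (1 : Fin 3) 2).injective.eq_iff]⟩

omit [FiniteDimensional ℝ E] in
theorem frameTwist_swap (p : M) : frameTwist g ![e 0, e 2, e 1] p = -frameTwist g e p := by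
  change -(1 / 2) * g.inner p (mlieBracket I (e 2) (e 1) p) (e 0 p)
    = -(-(1 / 2) * g.inner p (mlieBracket I (e 1) (e 2) p) (e 0 p))
  rw [mlieBracket_swap_apply, map_neg, neg_apply]
  ring

omit [FiniteDimensional ℝ E] in
theorem inner_frameRot_zero (h : IsOrthonormalOn g e U) {p : M} (hp : p ∈ U)
    (v : TangentSpace I p) : g.inner p (frameRot g e p v) (e 0 p) = 0 := by
  simp [frameRot_apply, h.inner_eq p hp]

theorem frameRot_frameRot (h : IsOrthonormalOn g e U) (hE : Module.finrank ℝ E = 3) {p : M}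
    (hp : p ∈ U) {v : TangentSpace I p} (hv : g.inner p v (e 0 p) = 0) :
    frameRot g e p (frameRot g e p v) = -v := by
  conv_rhs => rw [h.expand hE hp v, Fin.sum_univ_three, hv]
  rw [frameRot_apply e p v, map_sub, map_smul, map_smul, h.frameRot_one hp, h.frameRot_two hp]
  module

theorem inner_frameRot_frameRot (h : IsOrthonormalOn g e U) (hE : Module.finrank ℝ E = 3) {p : M}
    (hp : p ∈ U) (v : TangentSpace I p) {w : TangentSpace I p} (hw : g.inner p w (e 0 p) = 0) :
    g.inner p (frameRot g e p v) (frameRot g e p w) = g.inner p v w := by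
  conv_rhs => rw [h.expand hE hp w, Fin.sum_univ_three, hw]
  simp only [frameRot_apply, map_sub, map_add, map_smul, sub_apply, smul_apply, smul_eq_mul,
    h.inner_eq p hp]
  simp

end IsOrthonormalOn

/-- The covariant derivative of a unit Killing field is a field of endomorphisms. -/
theorem exists_covariantDerivative (hE : Module.finrank ℝ E = 3)
    (hξ : ContMDiff I I.tangent ∞ (T% ξ)) (hunit : ∀ p, g.inner p (ξ p) (ξ p) = 1)
    (hkill : IsKilling g ξ) :
    ∃ A : Π p : M, TangentSpace I p →L[ℝ] TangentSpace I p,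
      ∀ (e : Fin 3 → Π p : M, TangentSpace I p) (U : Set M), IsOrthonormalOn g e U → e 0 = ξ →
        ∀ p ∈ U, A p = frameTwist g e p • frameRot g e p := by
  -- A is characterized by `leviCivita`, without reference to a frame, so the local formula holds in
  -- every adapted frame at once.
  have hA : ∀ p : M, ∃ A : TangentSpace I p →L[ℝ] TangentSpace I p, ∀ v : TangentSpace I p,
      A v = leviCivita g (FiberBundle.extend E v : Π q : M, TangentSpace I q) ξ p := by
    intro p
    obtain ⟨e, U, hp, h, rfl⟩ := exists_orthonormal_frame hE hξ hunit p
    refine ⟨frameTwist g e p • frameRot g e p, fun v => ?_⟩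
    rw [h.leviCivita_left hE hkill hp (FiberBundle.mdifferentiableAt_extend I E v),
      FiberBundle.extend_apply_self, smul_apply]
  choose A hA using hA
  refine ⟨A, ?_⟩
  rintro e U h rfl p hp
  ext v
  rw [hA, h.leviCivita_left hE hkill hp (FiberBundle.mdifferentiableAt_extend I E v),
    FiberBundle.extend_apply_self, smul_apply]

variable {A : Π p : M, TangentSpace I p →L[ℝ] TangentSpace I p}

/-- In any adapted frame √f = |a|, so -Dξ / √f is the frame rotation times a sign s = -a/|a|. The
sign does not affect the algebraic identities, and it is smooth because a has no zeros. -/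
theorem isTransverseComplexStructure (hE : Module.finrank ℝ E = 3)
    (hξ : ContMDiff I I.tangent ∞ (T% ξ)) (hunit : ∀ p, g.inner p (ξ p) (ξ p) = 1)
    (hkill : IsKilling g ξ) (hpos : ∀ p, 0 < ricciFunction g ξ p)
    (hA : ∀ (e : Fin 3 → Π p : M, TangentSpace I p) (U : Set M), IsOrthonormalOn g e U → e 0 = ξ →
        ∀ p ∈ U, A p = frameTwist g e p • frameRot g e p) :
    IsTransverseComplexStructure g ξ (fun p => -(√(ricciFunction g ξ p))⁻¹ • A p) := by
  have hframe : ∀ p : M, ∃ (e : Fin 3 → Π p : M, TangentSpace I p) (s : ℝ), s * s = 1 ∧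
      (∃ U, p ∈ U ∧ IsOrthonormalOn g e U) ∧ e 0 = ξ ∧
        -(√(ricciFunction g ξ p))⁻¹ • A p = s • frameRot g e p := by
    intro p
    obtain ⟨e, U, hp, h, h0⟩ := exists_orthonormal_frame hE hξ hunit p
    refine ⟨e, -(√(ricciFunction g ξ p))⁻¹ * frameTwist g e p, ?_, ⟨U, hp, h⟩, h0, ?_⟩
    · have hf := hpos p
      have hs := Real.mul_self_sqrt hf.le
      have hne := Real.sqrt_ne_zero'.mpr hf
      subst h0
      rw [h.ricciFunction_eq hE hkill hp] at hs hne ⊢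
      field_simp
      rw [pow_two √_, hs]
    · rw [hA e U h h0 p hp, smul_smul]
  refine ⟨fun V X hV hX p hp => ?_, fun p => ?_, fun p v => ?_, fun p v hv => ?_,
    fun p v w hv hw => ?_⟩
  · obtain ⟨e, U, hpU, h, rfl⟩ := exists_orthonormal_frame hE hξ hunit p
    have : CompleteSpace E := FiniteDimensional.complete ℝ E
    have hVU : IsOpen (V ∩ U) := hV.inter h.isOpen
    have hX' := hX.mono (Set.inter_subset_left (t := U))
    have he : ∀ i, ContMDiffOn I I.tangent ∞ (T% (e i)) (V ∩ U) :=
      fun i => (h.smooth i).mono Set.inter_subset_right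
    have ha : ContMDiffOn I 𝓘(ℝ, ℝ) ∞ (frameTwist g e) (V ∩ U) :=
      h.contMDiffOn_frameTwist.mono Set.inter_subset_right
    have hr : ContMDiffOn I 𝓘(ℝ, ℝ) ∞ (fun q => -(√(frameTwist g e q ^ 2))⁻¹ * frameTwist g e q)
        (V ∩ U) := by
      have hi : ContMDiffOn I 𝓘(ℝ, ℝ) ∞ (fun q => -(√(frameTwist g e q ^ 2))⁻¹) (V ∩ U) := by
        intro q hq
        have hq2 : 0 < frameTwist g e q ^ 2 := by
          rw [← h.ricciFunction_eq hE hkill hq.2]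
          exact hpos q
        have hc : ContDiffAt ℝ ∞ (fun r : ℝ => -(√r)⁻¹) (frameTwist g e q ^ 2) :=
          ((Real.contDiffAt_sqrt hq2.ne').inv (Real.sqrt_ne_zero'.mpr hq2)).neg
        exact ContMDiffAt.comp_contMDiffWithinAt q (g := fun r : ℝ => -(√r)⁻¹) hc.contMDiffAt
          ((ha.pow 2) q hq)
      exact hi.mul ha
    have h1 := hr.smul_section (ContMDiffOn.sub_section
      ((contMDiffOn_inner g hX' (he 1)).smul_section (he 2))
      ((contMDiffOn_inner g hX' (he 2)).smul_section (he 1)))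
    have h2 : ContMDiffOn I I.tangent ∞
        (T% (fun q => (-(√(ricciFunction g (e 0) q))⁻¹ • A q) (X q))) (V ∩ U) := by
      refine h1.congr fun q hq => ?_
      rw [hA e U h rfl q hq.2, smul_smul, smul_apply, frameRot_apply,
        h.ricciFunction_eq hE hkill hq.2]
      rfl
    exact (h2.contMDiffAt (hVU.mem_nhds ⟨hp, hpU⟩)).contMDiffWithinAt
  · obtain ⟨e, s, hs, ⟨U, hp, h⟩, rfl, hj⟩ := hframe p
    rw [hj, smul_apply, h.frameRot_zero hp, smul_zero]
  · obtain ⟨e, s, hs, ⟨U, hp, h⟩, rfl, hj⟩ := hframe p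
    rw [hj, smul_apply, map_smul, smul_apply, h.inner_frameRot_zero hp, smul_zero]
  · obtain ⟨e, s, hs, ⟨U, hp, h⟩, rfl, hj⟩ := hframe p
    rw [hj, smul_apply, smul_apply, map_smul, smul_smul, hs, one_smul,
      h.frameRot_frameRot hE hp hv]
  · obtain ⟨e, s, hs, ⟨U, hp, h⟩, rfl, hj⟩ := hframe p
    rw [hj, smul_apply, smul_apply, map_smul, map_smul, smul_apply, smul_smul, hs, one_smul,
      h.inner_frameRot_frameRot hE hp v hw]

/-- The twist is ±√c at p, and exchanging e₁ and e₂ makes it negative. By continuity it stays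
negative nearby, where a² = c forces a = -√c; then -Dξ / √f is exactly the rotation of the frame. -/
theorem exists_frame_of_ricciFunction_eq (hE : Module.finrank ℝ E = 3)
    (hξ : ContMDiff I I.tangent ∞ (T% ξ)) (hunit : ∀ p, g.inner p (ξ p) (ξ p) = 1)
    (hkill : IsKilling g ξ) {c : ℝ} (hc : 0 < c) {O : Set M} (hO : IsOpen O)
    (hf : ∀ p ∈ O, ricciFunction g ξ p = c)
    (hA : ∀ (e : Fin 3 → Π p : M, TangentSpace I p) (U : Set M), IsOrthonormalOn g e U → e 0 = ξ →
        ∀ p ∈ U, A p = frameTwist g e p • frameRot g e p) {p : M} (hp : p ∈ O) :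
    ∃ (e : Fin 3 → Π p : M, TangentSpace I p) (U : Set M), p ∈ U ∧
      IsOrthonormalOn g e U ∧ e 0 = ξ ∧ (∀ q ∈ U, frameTwist g e q = -√c) ∧
        ∀ q ∈ U, -(√(ricciFunction g ξ q))⁻¹ • A q = frameRot g e q := by
  have : CompleteSpace E := FiniteDimensional.complete ℝ E
  obtain ⟨e, U, hpU, h, h0, hneg⟩ : ∃ (e : Fin 3 → Π p : M, TangentSpace I p) (U : Set M),
      p ∈ U ∧ IsOrthonormalOn g e U ∧ e 0 = ξ ∧ frameTwist g e p < 0 := by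
    obtain ⟨e, U, hpU, h, h0⟩ := exists_orthonormal_frame hE hξ hunit p
    have hsq : frameTwist g e p ^ 2 = c := by
      rw [← hf p hp, ← h.ricciFunction_eq hE (h0 ▸ hkill) hpU, h0]
    rcases lt_trichotomy (frameTwist g e p) 0 with hn | hz | hgt
    · exact ⟨e, U, hpU, h, h0, hn⟩
    · rw [hz] at hsq
      norm_num at hsq
      exact absurd hsq hc.ne
    · exact ⟨_, U, hpU, h.swap, h0, by
        rw [IsOrthonormalOn.frameTwist_swap]
        exact neg_neg_of_pos hgt⟩
  have hU' : IsOpen (U ∩ frameTwist g e ⁻¹' Set.Iio 0) :=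
    h.contMDiffOn_frameTwist.continuousOn.isOpen_inter_preimage h.isOpen isOpen_Iio
  have htw : ∀ q ∈ U ∩ frameTwist g e ⁻¹' Set.Iio 0 ∩ O, frameTwist g e q = -√c := by
    rintro q ⟨⟨hqU, hq⟩, hqO⟩
    have hq' : frameTwist g e q < 0 := hq
    have hsq : frameTwist g e q ^ 2 = c := by
      rw [← hf q hqO, ← h.ricciFunction_eq hE (h0 ▸ hkill) hqU, h0]
    rw [← hsq, Real.sqrt_sq_eq_abs, abs_of_neg hq', neg_neg]
  refine ⟨e, U ∩ frameTwist g e ⁻¹' Set.Iio 0 ∩ O, ⟨⟨hpU, hneg⟩, hp⟩,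
    h.mono (hU'.inter hO) fun q hq => hq.1.1, h0, htw, fun q hq => ?_⟩
  rw [hA e U h h0 q hq.1.1, htw q hq, hf q hq.2, smul_smul, neg_mul_neg,
    inv_mul_cancel₀ (Real.sqrt_ne_zero'.mpr hc), one_smul]

end Transverse

end SasakiCone

theorem proposition1 {M : Type*} [TopologicalSpace M] [T2Space M] [CompactSpace M]
    [ChartedSpace (EuclideanSpace ℝ (Fin 3)) M] [IsManifold (𝓡 3) ∞ M]
    (g : Bundle.ContMDiffRiemannianMetric (𝓡 3) ∞ (EuclideanSpace ℝ (Fin 3))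
      (fun p : M => TangentSpace (𝓡 3) p))
    (ξ : Π p : M, TangentSpace (𝓡 3) p)
    (hξ : ContMDiff (𝓡 3) (𝓡 3).tangent ∞ (T% ξ))
    (hunit : ∀ p, g.inner p (ξ p) (ξ p) = 1)
    (hgeo : ∀ p, SasakiCone.leviCivita g ξ ξ p = 0)
    (hkill : SasakiCone.IsKilling g ξ)
    (hpos : ∀ p, 0 < SasakiCone.ricciFunction g ξ p)
    (P₀ : M) (K : Set M) (hK : IsCompact K) (hP₀ : P₀ ∉ K)
    (c : ℝ) (hc : ∀ p, p ∉ K → SasakiCone.ricciFunction g ξ p = c) :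
    ∃ j : Π p : M, TangentSpace (𝓡 3) p →L[ℝ] TangentSpace (𝓡 3) p,
      SasakiCone.IsTransverseComplexStructure g ξ j ∧
      SasakiCone.IsKahlerOn ((𝓡 3).prod 𝓘(ℝ, ℝ))
        (SasakiCone.coneMetric g c) (SasakiCone.coneJ g ξ c j) (Kᶜ ×ˢ Set.Ioi (0 : ℝ)) := by
  have hE : Module.finrank ℝ (EuclideanSpace ℝ (Fin 3)) = 3 := finrank_euclideanSpace_fin
  -- c is the value of f at P₀, which lies outside K.
  have hc0 : 0 < c := hc P₀ hP₀ ▸ hpos P₀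
  have hO : IsOpen Kᶜ := hK.isClosed.isOpen_compl
  obtain ⟨A, hA⟩ := SasakiCone.exists_covariantDerivative hE hξ hunit hkill
  exact ⟨_, SasakiCone.isTransverseComplexStructure hE hξ hunit hkill hpos hA,
    SasakiCone.isKahlerOn_cone hE hkill hc0 hO fun p hp =>
      SasakiCone.exists_frame_of_ricciFunction_eq hE hξ hunit hkill hc0 hO hc hA hp⟩
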